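/- Let $\gamma>-1$. Let $\partial_+S\mathbb D=\mathbb S^1\times[-\pi/2,\pi/2]$, with coordinates $(\beta,\alpha)$, where $\mathbb S^1=\mathbb R/2\pi\mathbb Z$, let $\partial S\mathbb D=\mathbb S^1\times\mathbb S^1$, and put $\mu(\beta,\alpha)=\cos\alpha$ and $T=\partial_\beta-\partial_\alpha$. Let $\mathcal S(\beta,\alpha)=(\beta+\pi+2\alpha,\pi-\alpha)$ and $\mathcal S_A(\beta,\alpha)=(\beta+\pi+2\alpha,-\alpha)$. For $f:\partial_+S\mathbb D\to\mathbb C$ let $A_+f:\partial S\mathbb D\to\mathbb C$ be its $\mathcal S$-even extension, i.e. $A_+f=f$ on $\partial_+S\mathbb D$ and $A_+f=f\circ\mathcal S$ elsewhere, and set $$C^\infty_{\alpha,+,+}(\partial_+S\mathbb D)=\{f\in C^\infty(\partial_+S\mathbb D):\ A_+f\in C^\infty(\partial S\mathbb D),\ f\circ\mathcal S_A=f\}.$$ Let $L^2(\partial_+S\mathbb D,\mu^{-2\gamma})$ be the Hilbert space of complex-valued functions that are square-integrable for the measure $\mu^{-2\gamma}\,d\beta\,d\alpha$, and let $L^2_+(\partial_+S\mathbb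 D,\mu^{-2\gamma})$ be its closed subspace of those $u$ with $u\circ\mathcal S_A=u$ almost everywhere. **Theorem.** The differential expression $$\mathcal T_\gamma=-\mu^{2\gamma}\,T\,\mu^{-2\gamma}\,T+\gamma^2\,\mathrm{id}$$ defines a densely defined symmetric operator on the Hilbert space $L^2_+(\partial_+S\mathbb D,\mu^{-2\gamma})$ with domain $\mu^{2\gamma+1}C^\infty_{\alpha,+,+}(\partial_+S\mathbb D)$, and this operator is essentially self-adjoint, i.e. its closure is self-adjoint. -/

import Mathlib

open Real Set MeasureTheory
open scoped ContDiff ENNReal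

noncomputable section

namespace XRayDisk

/-- The circle `𝕊¹ = ℝ / 2πℤ`, carrying the arc-length measure of total mass `2π`. -/
abbrev Circ : Type := AddCircle (2 * π)

instance factTwoPi : Fact (0 < 2 * π) := ⟨Real.two_pi_pos⟩

/-- The interval `[-π/2, π/2]`. -/
abbrev AlphaRange : Type := Icc (-(π / 2)) (π / 2)

theorem neg_le_half : -(π / 2) ≤ π / 2 := by linarith [Real.pi_pos]

/-- The manifold `∂₊SD = 𝕊¹ × [-π/2, π/2]`, with fan-beam coordinates `(β, α)`. -/
abbrev FanBeam : Type := Circ × AlphaRange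

/-- A real number `a ∈ [-π/2, π/2]` as an element of that interval
(clamped to an endpoint for the other `a`). -/
def toAlpha (a : ℝ) : AlphaRange := projIcc (-(π / 2)) (π / 2) neg_le_half a

/-- The boundary defining function `μ(β, α) = cos α`. -/
def mu (p : FanBeam) : ℝ := Real.cos p.2

/-- The antipodal scattering relation `S_A(β, α) = (β + π + 2α, -α)` on `∂₊SD`. -/
def scatA (p : FanBeam) : FanBeam :=
  (p.1 + ((π + 2 * (p.2 : ℝ) : ℝ) : Circ), ⟨-(p.2 : ℝ), by
    have h := p.2.2
    exact ⟨by linarith [h.2], by linarith [h.1]⟩⟩)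

/-! ### Smooth functions -/

/-- `f ∈ C^∞(∂₊SD)`: `f` is smooth up to the boundary in the coordinates `(β, α)`. -/
def SmoothOnFanBeam (f : FanBeam → ℂ) : Prop :=
  ContDiffOn ℝ ∞ (fun p : ℝ × ℝ => f ((p.1 : Circ), toAlpha p.2))
    (univ ×ˢ Icc (-(π / 2)) (π / 2))

/-- `F ∈ C^∞(∂SD)`, where `∂SD = 𝕊¹ × 𝕊¹`: the lift of `F` to the universal cover is smooth. -/
def SmoothOnTorus (F : Circ × Circ → ℂ) : Prop :=
  ContDiff ℝ ∞ (fun p : ℝ × ℝ => F ((p.1 : Circ), (p.2 : Circ)))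

/-- The extension `A₊ f` of `f` from `∂₊SD` to `∂SD = 𝕊¹ × 𝕊¹`, even with respect to the
scattering relation `S(β, α) = (β + π + 2α, π - α)`. With `a ∈ [-π/2, 3π/2)` the representative
of `α`, the point `(β, α)` is in `∂₊SD` if `a ≤ π/2`, and otherwise `S(β, α)` is. -/
def evenExt (f : FanBeam → ℂ) (p : Circ × Circ) : ℂ :=
  let a : ℝ := (AddCircle.equivIco (2 * π) (-(π / 2)) p.2 : ℝ)
  if a ≤ π / 2 then f (p.1, toAlpha a)
  else f (p.1 + ((π + 2 * a : ℝ) : Circ), toAlpha (π - a))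

/-- The space `C^∞_{α,+,+}(∂₊SD)` of all smooth `f` on `∂₊SD` such that `A₊ f` is smooth on `∂SD`
and `S_A^* f = f`. -/
def CAlphaPP : Set (FanBeam → ℂ) :=
  {f | SmoothOnFanBeam f ∧ SmoothOnTorus (evenExt f) ∧ ∀ p, f (scatA p) = f p}

/-! ### The differential expression -/

/-- `∂_β u`. -/
def dBeta (u : FanBeam → ℂ) (p : FanBeam) : ℂ :=
  deriv (fun b : ℝ => u (p.1 + (b : Circ), p.2)) 0

/-- `∂_α u`, at the points with `-π/2 < α < π/2` (the others form a null set). -/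
def dAlpha (u : FanBeam → ℂ) (p : FanBeam) : ℂ :=
  deriv (fun a : ℝ => u (p.1, toAlpha a)) (p.2 : ℝ)

/-- The vector field `T = ∂_β - ∂_α`. -/
def vecT (u : FanBeam → ℂ) (p : FanBeam) : ℂ := dBeta u p - dAlpha u p

/-- The product `μ^s u`. -/
def muPow (s : ℝ) (u : FanBeam → ℂ) (p : FanBeam) : ℂ := ((mu p ^ s : ℝ) : ℂ) * u p

/-- The differential expression `T_γ u = -μ^{2γ} T (μ^{-2γ} T u) + γ² u`. -/
def exprT (γ : ℝ) (u : FanBeam → ℂ) (p : FanBeam) : ℂ :=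
  -muPow (2 * γ) (vecT (muPow (-2 * γ) (vecT u))) p + ((γ ^ 2 : ℝ) : ℂ) * u p

/-! ### The Hilbert space -/

/-- The area measure `dβ dα` on `∂₊SD`. -/
def area : Measure FanBeam :=
  (volume : Measure Circ).prod (Measure.comap (Subtype.val : AlphaRange → ℝ) volume)

/-- The measure `μ^{-2γ} dβ dα` on `∂₊SD`. -/
def wMeasure (γ : ℝ) : Measure FanBeam :=
  area.withDensity (fun p => ENNReal.ofReal (mu p ^ (-2 * γ)))

instance sfinite_comap :
    SFinite (Measure.comap (Subtype.val : AlphaRange → ℝ) (volume : Measure ℝ)) := by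
  have : IsFiniteMeasure
      (Measure.comap (Subtype.val : AlphaRange → ℝ) (volume : Measure ℝ)) := by
    refine ⟨?_⟩
    rw [(MeasurableEmbedding.subtype_coe measurableSet_Icc).comap_apply]
    refine lt_of_le_of_lt (measure_mono (t := Icc (-(π / 2)) (π / 2)) ?_) (by simp)
    rintro _ ⟨x, -, rfl⟩
    exact x.2
  infer_instance

theorem measurable_scatA : Measurable scatA := by
  refine Continuous.measurable ?_
  unfold scatA
  refine Continuous.prodMk ?_ ?_
  · refine continuous_fst.add ((AddCircle.continuous_mk' (2 * π)).comp ?_)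
    fun_prop
  · refine Continuous.subtype_mk ?_ _
    fun_prop

theorem mu_scatA (p : FanBeam) : mu (scatA p) = mu p := by
  simp [mu, scatA]

theorem measurable_mu : Measurable mu := by
  unfold mu
  fun_prop

theorem measurePreserving_neg_alpha :
    MeasurePreserving
      (fun a : AlphaRange => (⟨-(a : ℝ), by
        have h := a.2
        exact ⟨by linarith [h.2], by linarith [h.1]⟩⟩ : AlphaRange))
      (Measure.comap Subtype.val volume) (Measure.comap Subtype.val volume) := by
  have hm : Measurable (fun a : AlphaRange => (⟨-(a : ℝ), by
        have h := a.2
        exact ⟨by linarith [h.2], by linarith [h.1]⟩⟩ : AlphaRange)) := by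
    refine Measurable.subtype_mk ?_
    fun_prop
  refine ⟨hm, ?_⟩
  have he := MeasurableEmbedding.subtype_coe (measurableSet_Icc (a := -(π / 2)) (b := π / 2))
  ext s hs
  rw [Measure.map_apply hm hs, he.comap_apply, he.comap_apply,
    ← Measure.measure_neg (volume : Measure ℝ) (Subtype.val '' s)]
  congr 1
  ext x
  constructor
  · rintro ⟨a, ha, rfl⟩
    exact ⟨_, ha, rfl⟩
  · rintro ⟨a, ha, hx⟩
    have h := a.2
    refine ⟨⟨x, ?_⟩, ?_, rfl⟩
    · exact ⟨by linarith [h.2], by linarith [h.1]⟩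
    · have : a = ⟨-x, by rw [← hx]; exact a.2⟩ := Subtype.ext hx
      rw [mem_preimage]
      rw [this] at ha
      exact ha

theorem measurePreserving_scatA_area : MeasurePreserving scatA area area := by
  have h1 := measurePreserving_neg_alpha.skew_product
    (μc := (volume : Measure Circ)) (μd := (volume : Measure Circ))
    (g := fun a b => b + ((π + 2 * (a : ℝ) : ℝ) : Circ)) (by
      refine Continuous.measurable ?_
      refine continuous_snd.add ((AddCircle.continuous_mk' (2 * π)).comp ?_)
      fun_prop)
    (Filter.Eventually.of_forall fun a => (measurePreserving_add_right volume _).map_eq)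
  exact (Measure.measurePreserving_swap.comp h1).comp Measure.measurePreserving_swap

/-- `S_A` preserves the measure `μ^{-2γ} dβ dα`, so that `S_A^*` acts on `L²`. -/
theorem measurePreserving_scatA (γ : ℝ) :
    MeasurePreserving scatA (wMeasure γ) (wMeasure γ) := by
  refine ⟨measurable_scatA, ?_⟩
  have hd : Measurable (fun p : FanBeam => ENNReal.ofReal (mu p ^ (-2 * γ))) :=
    (measurable_mu.pow_const _).ennreal_ofReal
  ext s hs
  rw [Measure.map_apply measurable_scatA hs, wMeasure,
    withDensity_apply _ (measurable_scatA hs), withDensity_apply _ hs,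
    ← measurePreserving_scatA_area.setLIntegral_comp_preimage hs hd]
  simp only [mu_scatA]

/-- The space `L²(∂₊SD, μ^{-2γ} dβ dα)` of complex-valued functions. -/
abbrev L2w (γ : ℝ) : Type := Lp ℂ 2 (wMeasure γ)

/-- The pullback `S_A^* : u ↦ u ∘ S_A` on `L²(∂₊SD, μ^{-2γ})`. -/
def pullA (γ : ℝ) : L2w γ →L[ℂ] L2w γ :=
  (Lp.compMeasurePreservingₗᵢ ℂ scatA (measurePreserving_scatA γ)).toContinuousLinearMap

/-- The Hilbert space `L²₊(∂₊SD, μ^{-2γ}) = L²(∂₊SD, μ^{-2γ}) ∩ ker (Id - S_A^*)`. -/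
def L2plus (γ : ℝ) : Submodule ℂ (L2w γ) :=
  LinearMap.ker (ContinuousLinearMap.id ℂ (L2w γ) - pullA γ).toLinearMap

instance completeL2plus (γ : ℝ) : CompleteSpace (L2plus γ) :=
  (ContinuousLinearMap.isClosed_ker
    (ContinuousLinearMap.id ℂ (L2w γ) - pullA γ)).completeSpace_coe

/-! ### Operators -/

/-- `A` is the unbounded operator on `L²₊(∂₊SD, μ^{-2γ})` given by the differential expression
`T_γ` on the domain `μ^{2γ+1} C^∞_{α,+,+}(∂₊SD)`: the domain of `A` consists exactly of the classes
of the functions `μ^{2γ+1} f` with `f` in `C^∞_{α,+,+}(∂₊SD)`, each such function does have a class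
in `L²₊`, and `A` sends it to the class of `T_γ (μ^{2γ+1} f)`. At most one `A` has this property
(`IsOperatorT.unique`). -/
structure IsOperatorT (γ : ℝ) (A : L2plus γ →ₗ.[ℂ] L2plus γ) : Prop where
  mem_domain : ∀ u : L2plus γ, u ∈ A.domain ↔
    ∃ f ∈ CAlphaPP, ((u : L2w γ) : FanBeam → ℂ) =ᵐ[wMeasure γ] muPow (2 * γ + 1) f
  exists_class : ∀ f ∈ CAlphaPP, ∃ u : A.domain,
    (((u : L2plus γ) : L2w γ) : FanBeam → ℂ) =ᵐ[wMeasure γ] muPow (2 * γ + 1) f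
  apply_eq : ∀ u : A.domain, ∀ f ∈ CAlphaPP,
    (((u : L2plus γ) : L2w γ) : FanBeam → ℂ) =ᵐ[wMeasure γ] muPow (2 * γ + 1) f →
    ((A u : L2w γ) : FanBeam → ℂ) =ᵐ[wMeasure γ] exprT γ (muPow (2 * γ + 1) f)

theorem IsOperatorT.unique {γ : ℝ} {A B : L2plus γ →ₗ.[ℂ] L2plus γ}
    (hA : IsOperatorT γ A) (hB : IsOperatorT γ B) : A = B := by
  have hd : A.domain = B.domain := by
    ext u
    rw [hA.mem_domain, hB.mem_domain]
  refine LinearPMap.dExt hd ?_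
  intro x y hxy
  obtain ⟨f, hf, hx⟩ := (hA.mem_domain x).1 x.2
  have h1 := hA.apply_eq x f hf hx
  have h2 := hB.apply_eq y f hf (by rw [← hxy]; exact hx)
  exact Subtype.ext (Lp.ext (h1.trans h2.symm))

/-- A densely defined symmetric operator on a complex Hilbert space is essentially self-adjoint
if it is closable and its closure is self-adjoint. -/
structure IsEssentiallySelfAdjoint {H : Type*} [NormedAddCommGroup H] [InnerProductSpace ℂ H]
    [CompleteSpace H] (A : H →ₗ.[ℂ] H) : Prop where
  dense_domain : Dense (A.domain : Set H)
  symmetric : A.IsFormalAdjoint A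
  closable : A.IsClosable
  closure_selfAdjoint : IsSelfAdjoint A.closure

end XRayDisk

end

/-!
In the coordinates `(ω, α)` with `ω = β + α`, the vector field `T` is `-∂_α`, the scattering
relation `S` is `(ω, α) ↦ (ω, π - α)`, and `S_A` is `(ω, α) ↦ (ω + π, -α)`. Writing elements of the
domain as `μ^{2γ+1} f`, a computation on the interior (`exprT_eq`) gives
`T_γ (μ^{2γ+1} f) = μ^{2γ+1} g` with `g = -∂_α² f + (2γ + 2) tan α ∂_α f + (γ + 1)² f`
(`reducedOp`). As the `S`-even extension of `f` is smooth, `∂_α f` vanishes at `α = ±π/2`, so that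
`g` is bounded, and `γ > -1` puts `μ^{2γ+1} g` in `L²(μ^{-2γ})`.

The operator is symmetric because Lagrange's identity on each geodesic `ω = const` has the boundary
terms `μ^{2γ+2} (f̄ ∂_α h - ∂_α f̄ h)`, which vanish at both ends (`integral_lagrange`).

For essential self-adjointness it remains to see that the ranges of `T_γ ± i` are dense
(`exists_isEssentiallySelfAdjoint`). On the functions `(sin α)^n e^{ikω}` with `n + k` even the
expression `g` is `(n + γ + 1)² (sin α)^n e^{ikω} - n (n - 1) (sin α)^{n-2} e^{ikω}`
(`reducedOp_monomial`). This triangular system has real diagonal, so that a vector orthogonal to the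
range of `T_γ ± i` is orthogonal to all `μ^{2γ+1} (sin α)^n e^{ikω}` by induction on `n`
(`eq_zero_of_inner_valueMap_add`), and these are total by the Stone–Weierstrass theorem
(`eq_zero_of_inner_evenMonomial`).
-/

noncomputable section

namespace XRayDisk

/-! ### A criterion for essential self-adjointness -/

section Criterion

variable {H V : Type*} [NormedAddCommGroup H] [InnerProductSpace ℂ H]
  [AddCommGroup V] [Module ℂ V]

/-- The heart of the criterion: a vector of the graph of the adjoint that is orthogonal to the
graph `{(J f, K f)}` vanishes, because the ranges of `K ± i J` are dense. -/
theorem eq_zero_of_mem_adjoint_of_orthogonal (J K : V →ₗ[ℂ] H)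
    (hplus : ∀ x, (∀ f, inner ℂ x (K f + Complex.I • J f) = 0) → x = 0)
    (hminus : ∀ x, (∀ f, inner ℂ x (K f - Complex.I • J f) = 0) → x = 0) {v w : H}
    (hadj : ∀ f, inner ℂ v (K f) = inner ℂ w (J f))
    (horth : ∀ f, inner ℂ v (J f) + inner ℂ w (K f) = 0) : v = 0 ∧ w = 0 := by
  have hw : ∀ f, inner ℂ w (K f) = -inner ℂ v (J f) := fun f =>
    eq_neg_of_add_eq_zero_right (horth f)
  have h1 : w + Complex.I • v = 0 := hplus _ fun f => by
    simp only [inner_add_left, inner_add_right, inner_smul_left, inner_smul_right, hw, ← hadj,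
      Complex.conj_I]
    linear_combination (-inner ℂ v (J f)) * Complex.I_mul_I
  have h2 : w - Complex.I • v = 0 := hminus _ fun f => by
    simp only [inner_sub_left, inner_sub_right, inner_smul_left, inner_smul_right, hw, ← hadj,
      Complex.conj_I]
    linear_combination (-inner ℂ v (J f)) * Complex.I_mul_I
  have hw0 : w = 0 := by
    have h3 : (2 : ℂ) • w = 0 := by
      have h3 : (w + Complex.I • v) + (w - Complex.I • v) = 0 := by rw [h1, h2, add_zero]
      rw [two_smul, ← h3]
      abel
    exact (smul_eq_zero.1 h3).resolve_left two_ne_zero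
  rw [hw0, zero_add] at h1
  exact ⟨(smul_eq_zero.1 h1).resolve_left Complex.I_ne_zero, hw0⟩

/-- The operator with graph `{(J f, K f)}` is well defined and essentially self-adjoint if it is
symmetric and the ranges of `J` and `K ± i J` are dense. Density is phrased as the vanishing of the
orthogonal complement. -/
theorem exists_isEssentiallySelfAdjoint [CompleteSpace H] (J K : V →ₗ[ℂ] H)
    (hsymm : ∀ f g, inner ℂ (K f) (J g) = inner ℂ (J f) (K g))
    (hdense : ∀ x, (∀ f, inner ℂ x (J f) = 0) → x = 0)
    (hplus : ∀ x, (∀ f, inner ℂ x (K f + Complex.I • J f) = 0) → x = 0)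
    (hminus : ∀ x, (∀ f, inner ℂ x (K f - Complex.I • J f) = 0) → x = 0) :
    ∃ A : H →ₗ.[ℂ] H, A.graph = LinearMap.range (J.prod K) ∧ IsEssentiallySelfAdjoint A := by
  -- symmetry and density of the range of `J` make `J f ↦ K f` well defined
  have hgraph : (LinearMap.range (J.prod K)).toLinearPMap.graph = LinearMap.range (J.prod K) := by
    refine Submodule.toLinearPMap_graph_eq _ ?_
    rintro _ ⟨f, rfl⟩ (hf : J f = 0)
    refine hdense _ fun g => ?_
    change inner ℂ (K f) (J g) = 0
    rw [hsymm, hf, inner_zero_left]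
  generalize (LinearMap.range (J.prod K)).toLinearPMap = A at hgraph
  have hJK : ∀ x : A.domain, ∃ f, J f = x ∧ K f = A x := by
    intro x
    have hx := A.mem_graph x
    rw [hgraph] at hx
    obtain ⟨f, hf⟩ := hx
    exact ⟨f, congrArg Prod.fst hf, congrArg Prod.snd hf⟩
  have hdom : ∀ f, ∃ x : A.domain, J f = x ∧ K f = A x := by
    intro f
    have hf : (J f, K f) ∈ A.graph := by
      rw [hgraph]
      exact ⟨f, rfl⟩
    rw [LinearPMap.mem_graph_iff] at hf
    obtain ⟨x, hx, hx'⟩ := hf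
    exact ⟨x, hx.symm, hx'.symm⟩
  have hd : Dense (A.domain : Set H) := by
    rw [Submodule.dense_iff_topologicalClosure_eq_top, Submodule.topologicalClosure_eq_top_iff,
      Submodule.eq_bot_iff]
    intro x hx
    refine hdense x fun f => ?_
    obtain ⟨y, hy, -⟩ := hdom f
    rw [hy]
    exact Submodule.inner_left_of_mem_orthogonal y.2 hx
  have hs : A.IsFormalAdjoint A := by
    intro x y
    obtain ⟨f, hf, hf'⟩ := hJK x
    obtain ⟨g, hg, hg'⟩ := hJK y
    rw [← hf, ← hf', ← hg, ← hg', hsymm]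
  have hclosed : A.adjoint.IsClosed := LinearPMap.adjoint_isClosed hd
  have hle : A ≤ A.adjoint := LinearPMap.IsFormalAdjoint.le_adjoint hd hs
  have hcl : A.IsClosable := LinearPMap.isClosable_iff_exists_closed_extension.2 ⟨_, hclosed, hle⟩
  have hcle : A.closure.graph ≤ A.adjoint.graph := by
    rw [← hcl.graph_closure_eq_closure_graph]
    exact Submodule.topologicalClosure_minimal _ (LinearPMap.le_graph_of_le hle) hclosed
  have hmem : ∀ {v w : H}, (v, w) ∈ A.adjoint.graph → ∀ f, inner ℂ v (K f) = inner ℂ w (J f) := by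
    intro v w hvw f
    rw [LinearPMap.mem_graph_iff] at hvw
    obtain ⟨y, hy, hy'⟩ := hvw
    obtain ⟨x, hx, hx'⟩ := hdom f
    simp only at hy hy'
    rw [hx, hx', ← hy, ← hy', LinearPMap.adjoint_isFormalAdjoint hd y x]
  -- the graph of the closure has no orthogonal complement in the graph of the adjoint
  have hge : A.adjoint.graph ≤ A.closure.graph := by
    rintro ⟨v, w⟩ hvw
    let e := WithLp.prodContinuousLinearEquiv 2 ℂ H H
    let M : Submodule ℂ (WithLp 2 (H × H)) := A.closure.graph.comap e.toLinearMap
    have hM : IsClosed (M : Set (WithLp 2 (H × H))) := hcl.closure_isClosed.preimage e.continuous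
    have : CompleteSpace M := hM.completeSpace_coe
    obtain ⟨m, hm, n, hn, hmn⟩ := M.exists_add_mem_mem_orthogonal (WithLp.toLp 2 (v, w))
    have hnadj : (n.fst, n.snd) ∈ A.adjoint.graph := by
      have h1 : (m.fst, m.snd) ∈ A.adjoint.graph := hcle hm
      have h2 := A.adjoint.graph.sub_mem hvw h1
      convert h2 using 1
      have h3 := congrArg WithLp.ofLp hmn
      have h4 : (v, w) = (m.fst, m.snd) + (n.fst, n.snd) := h3
      rw [h4, add_sub_cancel_left]
    have hz := eq_zero_of_mem_adjoint_of_orthogonal J K hplus hminus (hmem hnadj) fun f => by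
      obtain ⟨x, hx, hx'⟩ := hdom f
      have hxM : WithLp.toLp 2 (J f, K f) ∈ M := by
        refine LinearPMap.le_graph_of_le A.le_closure ?_
        rw [hx, hx']
        exact A.mem_graph x
      have := Submodule.inner_left_of_mem_orthogonal hxM hn
      simpa [WithLp.prod_inner_apply] using this
    have hvm : (v, w) = (m.fst, m.snd) := by
      have h3 : (v, w) = (m.fst, m.snd) + (n.fst, n.snd) := congrArg WithLp.ofLp hmn
      rw [h3, hz.1, hz.2]
      simp
    rw [hvm]
    exact hm
  have heq : A.adjoint = A.closure := LinearPMap.eq_of_eq_graph (le_antisymm hge hcle)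
  refine ⟨A, hgraph, hd, hs, hcl, ?_⟩
  rw [LinearPMap.isSelfAdjoint_def]
  have hdc : Dense (A.closure.domain : Set H) := hd.mono A.le_closure.1
  -- an operator and its closure have the same adjoint
  refine LinearPMap.eq_of_eq_graph ?_
  rw [LinearPMap.adjoint_graph_eq_graph_adjoint hdc]
  nth_rw 2 [← heq]
  rw [LinearPMap.adjoint_graph_eq_graph_adjoint hd]
  ext ⟨x, y⟩
  simp only [Submodule.mem_adjoint_iff]
  refine ⟨fun h a b hab => h a b (LinearPMap.le_graph_of_le A.le_closure hab), fun h a b hab => ?_⟩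
  have hc : IsClosed {p : H × H | inner ℂ p.2 x - inner ℂ p.1 y = (0 : ℂ)} :=
    isClosed_eq (by fun_prop) continuous_const
  rw [← hcl.graph_closure_eq_closure_graph] at hab
  exact closure_minimal (fun p hp => h p.1 p.2 hp) hc hab

end Criterion

/-! ### Geodesic coordinates -/

/-- The derivative of `H` in the second variable. -/
def dSnd (H : ℝ × ℝ → ℂ) (p : ℝ × ℝ) : ℂ := fderiv ℝ H p (0, 1)

theorem contDiff_dSnd {H : ℝ × ℝ → ℂ} (hH : ContDiff ℝ ∞ H) : ContDiff ℝ ∞ (dSnd H) :=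
  (hH.fderiv_right (m := ∞) (by simp)).clm_apply contDiff_const

theorem hasDerivAt_dSnd {H : ℝ × ℝ → ℂ} {w a : ℝ} (hH : DifferentiableAt ℝ H (w, a)) :
    HasDerivAt (fun t => H (w, t)) (dSnd H (w, a)) a := by
  have h1 : HasDerivAt (fun t : ℝ => ((w, t) : ℝ × ℝ)) (0, 1) a :=
    (hasDerivAt_const a w).prodMk (hasDerivAt_id a)
  exact hH.hasFDerivAt.comp_hasDerivAt a h1

theorem dSnd_eq_of_hasDerivAt {H : ℝ × ℝ → ℂ} {w a : ℝ} {d : ℂ}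
    (hH : DifferentiableAt ℝ H (w, a)) (hd : HasDerivAt (fun t => H (w, t)) d a) :
    dSnd H (w, a) = d :=
  (hasDerivAt_dSnd hH).unique hd

theorem dSnd_periodic {H : ℝ × ℝ → ℂ} (hH : ContDiff ℝ ∞ H)
    (hper : ∀ w a, H (w + 2 * π, a) = H (w, a)) (w a : ℝ) :
    dSnd H (w + 2 * π, a) = dSnd H (w, a) := by
  refine dSnd_eq_of_hasDerivAt (hH.differentiable (by simp) _) ?_
  simp only [hper]
  exact hasDerivAt_dSnd (hH.differentiable (by simp) _)

theorem dSnd_reflect {H G : ℝ × ℝ → ℂ} (hH : ContDiff ℝ ∞ H) (hG : ContDiff ℝ ∞ G) {w v : ℝ}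
    (h : ∀ a ∈ Ioo (-(π / 2)) (π / 2), H (v, -a) = G (w, a)) {a : ℝ}
    (ha : a ∈ Ioo (-(π / 2)) (π / 2)) : dSnd H (v, -a) = -dSnd G (w, a) := by
  have h1 : HasDerivAt (fun t => H (v, -t)) (-dSnd H (v, -a)) a := by
    have := (hasDerivAt_dSnd (hH.differentiable (by simp) (v, -a))).scomp a (hasDerivAt_neg a)
    simpa using! this
  have h2 : HasDerivAt (fun t => H (v, -t)) (dSnd G (w, a)) a :=
    (hasDerivAt_dSnd (hG.differentiable (by simp) (w, a))).congr_of_eventuallyEq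
      (Filter.eventually_of_mem (isOpen_Ioo.mem_nhds ha) h)
  rw [← h1.unique h2, neg_neg]

/-- The even extension of `f` in the coordinates `(ω, α) = (β + α, α)`, lifted to the universal
cover. In them `T = -∂_α`, the scattering relation `S` is `(ω, α) ↦ (ω, π - α)`, and `S_A` is
`(ω, α) ↦ (ω + π, -α)`. -/
def geoLift (f : FanBeam → ℂ) (p : ℝ × ℝ) : ℂ :=
  evenExt f (((p.1 - p.2 : ℝ) : Circ), (p.2 : Circ))

theorem contDiff_geoLift {f : FanBeam → ℂ} (hf : f ∈ CAlphaPP) : ContDiff ℝ ∞ (geoLift f) :=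
  ContDiff.comp (g := fun p : ℝ × ℝ => evenExt f ((p.1 : Circ), (p.2 : Circ))) hf.2.1
    ((contDiff_fst.sub contDiff_snd).prodMk contDiff_snd)

theorem geoLift_periodic (f : FanBeam → ℂ) (w a : ℝ) :
    geoLift f (w + 2 * π, a) = geoLift f (w, a) := by
  have : w + 2 * π - a = (w - a) + 2 * π := by ring
  simp only [geoLift, this, AddCircle.coe_add_period]

theorem coe_toAlpha {a : ℝ} (ha : a ∈ Icc (-(π / 2)) (π / 2)) : (toAlpha a : ℝ) = a := by
  rw [toAlpha, projIcc_of_mem _ ha]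

theorem toAlpha_coe (a : AlphaRange) : toAlpha a = a := projIcc_val _ a

theorem evenExt_coe {f : FanBeam → ℂ} (b : Circ) {a : ℝ}
    (ha : a ∈ Ico (-(π / 2)) (-(π / 2) + 2 * π)) :
    evenExt f (b, (a : Circ)) = if a ≤ π / 2 then f (b, toAlpha a)
      else f (b + ((π + 2 * a : ℝ) : Circ), toAlpha (π - a)) := by
  simp only [evenExt, AddCircle.equivIco_coe_of_mem ha]

theorem geoLift_apply (f : FanBeam → ℂ) (b : ℝ) {a : ℝ} (ha : a ∈ Icc (-(π / 2)) (π / 2)) :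
    geoLift f (b + a, a) = f ((b : Circ), toAlpha a) := by
  have hπ := Real.pi_pos
  rw [geoLift, evenExt_coe _ ⟨ha.1, by linarith [ha.2]⟩, if_pos ha.2, add_sub_cancel_right]

theorem geoLift_pi_sub (f : FanBeam → ℂ) (w : ℝ) {a : ℝ}
    (ha : a ∈ Ioo (-(π / 2)) (-(π / 2) + 2 * π)) : geoLift f (w, π - a) = geoLift f (w, a) := by
  have hπ := Real.pi_pos
  have key : ∀ t, π / 2 < t → t < -(π / 2) + 2 * π →
      geoLift f (w, π - t) = geoLift f (w, t) := by
    intro t h1 h2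
    have h3 := geoLift_apply f (w - (π - t)) (a := π - t) ⟨by linarith, by linarith⟩
    rw [sub_add_cancel] at h3
    rw [h3, geoLift, evenExt_coe _ ⟨by linarith, h2⟩, if_neg (by linarith)]
    congr 2
    rw [← AddCircle.coe_add, ← AddCircle.coe_add_period]
    congr 1
    ring
  rcases lt_trichotomy a (π / 2) with h | rfl | h
  · have := key (π - a) (by linarith) (by linarith [ha.1])
    rw [sub_sub_cancel] at this
    exact this.symm
  · rw [sub_half]
  · exact key a h ha.2

theorem geoLift_neg {f : FanBeam → ℂ} (hf : f ∈ CAlphaPP) (w : ℝ) {a : ℝ}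
    (ha : a ∈ Icc (-(π / 2)) (π / 2)) : geoLift f (w + π, -a) = geoLift f (w, a) := by
  have ha' : -a ∈ Icc (-(π / 2)) (π / 2) := ⟨by linarith [ha.2], by linarith [ha.1]⟩
  have h1 := geoLift_apply f (w - a) ha
  have h2 := geoLift_apply f (w + π + a) ha'
  rw [sub_add_cancel] at h1
  rw [add_neg_cancel_right] at h2
  rw [h1, h2, ← hf.2.2 (_, toAlpha a)]
  congr 1
  refine Prod.ext ?_ (Subtype.ext ?_)
  · simp only [scatA, coe_toAlpha ha]
    rw [← AddCircle.coe_add]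
    congr 1
    ring
  · simp only [scatA, coe_toAlpha ha, coe_toAlpha ha']

theorem dSnd_geoLift_neg {f : FanBeam → ℂ} (hf : f ∈ CAlphaPP) (w : ℝ) {a : ℝ}
    (ha : a ∈ Ioo (-(π / 2)) (π / 2)) :
    dSnd (geoLift f) (w + π, -a) = -dSnd (geoLift f) (w, a) :=
  dSnd_reflect (contDiff_geoLift hf) (contDiff_geoLift hf)
    (fun _ ht => geoLift_neg hf w (Ioo_subset_Icc_self ht)) ha

theorem dSnd_dSnd_geoLift_neg {f : FanBeam → ℂ} (hf : f ∈ CAlphaPP) (w : ℝ) {a : ℝ}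
    (ha : a ∈ Ioo (-(π / 2)) (π / 2)) :
    dSnd (dSnd (geoLift f)) (w + π, -a) = dSnd (dSnd (geoLift f)) (w, a) := by
  have hs := contDiff_dSnd (contDiff_geoLift hf)
  have h := dSnd_reflect (G := fun p => -dSnd (geoLift f) p) hs hs.neg
    (fun _ ht => dSnd_geoLift_neg hf w ht) ha
  rw [h, neg_eq_iff_eq_neg]
  exact dSnd_eq_of_hasDerivAt (hs.neg.differentiable (by simp) _)
    (hasDerivAt_dSnd (hs.differentiable (by simp) _)).neg

/-- Evenness about `α = π/2` makes the normal derivative vanish there. -/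
theorem dSnd_geoLift_right {f : FanBeam → ℂ} (hf : f ∈ CAlphaPP) (w : ℝ) :
    dSnd (geoLift f) (w, π / 2) = 0 := by
  have hπ := Real.pi_pos
  have h0 := hasDerivAt_dSnd ((contDiff_geoLift hf).differentiable (by simp) (w, π / 2))
  have h1 : HasDerivAt (fun t => geoLift f (w, π - t)) (-dSnd (geoLift f) (w, π / 2)) (π / 2) := by
    have h := HasDerivAt.scomp (h := fun t => π - t) (h' := -1) (π / 2)
      (by rw [sub_half]; exact h0) (by simpa using (hasDerivAt_id (π / 2)).const_sub π)
    simpa using! h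
  have h2 : HasDerivAt (fun t => geoLift f (w, π - t)) (dSnd (geoLift f) (w, π / 2)) (π / 2) :=
    h0.congr_of_eventuallyEq (Filter.eventually_of_mem
      (isOpen_Ioo.mem_nhds ⟨by linarith, by linarith⟩) fun t ht => geoLift_pi_sub f w ht)
  exact self_eq_neg.1 (h2.unique h1)

theorem dSnd_geoLift_left {f : FanBeam → ℂ} (hf : f ∈ CAlphaPP) (w : ℝ) :
    dSnd (geoLift f) (w, -(π / 2)) = 0 := by
  have hπ := Real.pi_pos
  have hs := (contDiff_dSnd (contDiff_geoLift hf)).continuous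
  -- the symmetry under `S_A` carries the end `α = -π/2` to the end `α = π/2`
  have h : EqOn (fun t => dSnd (geoLift f) (w - π + π, -t)) (fun t => -dSnd (geoLift f) (w - π, t))
      (closure (Ioo (-(π / 2)) (π / 2))) :=
    EqOn.closure (fun t ht => dSnd_geoLift_neg hf (w - π) ht) (by fun_prop) (by fun_prop)
  rw [closure_Ioo (by linarith)] at h
  have h1 := h (right_mem_Icc.2 neg_le_half)
  simpa [dSnd_geoLift_right hf] using h1

/-! ### Bounds -/

theorem exists_norm_le_of_periodic {H : ℝ × ℝ → ℂ} (hH : Continuous H)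
    (hper : ∀ w a, H (w + 2 * π, a) = H (w, a)) :
    ∃ C, ∀ w, ∀ a ∈ Icc (-(π / 2)) (π / 2), ‖H (w, a)‖ ≤ C := by
  obtain ⟨C, hC⟩ := ((isCompact_Icc (a := (0 : ℝ)) (b := 2 * π)).prod
    (isCompact_Icc (a := -(π / 2)) (b := π / 2))).exists_bound_of_continuousOn hH.continuousOn
  refine ⟨C, fun w a ha => ?_⟩
  obtain ⟨y, hy, hwy⟩ := Function.Periodic.exists_mem_Ico₀ (f := fun w => H (w, a))
    (fun w => hper w a) Real.two_pi_pos w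
  rw [show H (w, a) = H (y, a) from hwy]
  exact hC _ ⟨Ico_subset_Icc_self hy, ha⟩

/-- The first derivative vanishes to first order at both ends, where `cos α` does too. -/
theorem exists_norm_dSnd_geoLift_le {f : FanBeam → ℂ} (hf : f ∈ CAlphaPP) :
    ∃ C, ∀ w, ∀ a ∈ Icc (-(π / 2)) (π / 2), ‖dSnd (geoLift f) (w, a)‖ ≤ C * Real.cos a := by
  have hπ := Real.pi_pos
  have hs := contDiff_dSnd (contDiff_geoLift hf)
  obtain ⟨M, hM⟩ := exists_norm_le_of_periodic (contDiff_dSnd hs).continuous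
    (dSnd_periodic hs (dSnd_periodic (contDiff_geoLift hf) (geoLift_periodic f)))
  have hM0 : 0 ≤ M := (norm_nonneg _).trans (hM 0 0 ⟨by linarith, by linarith⟩)
  refine ⟨M * (π / 2), fun w a ha => ?_⟩
  have hmvt : ∀ c ∈ Icc (-(π / 2)) (π / 2),
      ‖dSnd (geoLift f) (w, a) - dSnd (geoLift f) (w, c)‖ ≤ M * ‖a - c‖ := fun c hc =>
    Convex.norm_image_sub_le_of_norm_hasDerivWithin_le
      (f := fun t => dSnd (geoLift f) (w, t)) (f' := fun t => dSnd (dSnd (geoLift f)) (w, t))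
      (fun t _ => (hasDerivAt_dSnd (hs.differentiable (by simp) _)).hasDerivWithinAt)
      (fun t ht => hM w t ht) (convex_Icc _ _) hc ha
  have hle : ∀ x : ℝ, 0 ≤ x → x ≤ π / 2 → x ≤ π / 2 * Real.sin x := fun x h0 h1 => by
    have h := mul_le_mul_of_nonneg_left (Real.mul_le_sin h0 h1) (by linarith : 0 ≤ π / 2)
    have h2 : π / 2 * (2 / π * x) = x := by field_simp
    rwa [h2] at h
  rw [mul_assoc]
  rcases le_total 0 a with h | h
  · have h1 := hmvt _ (right_mem_Icc.2 neg_le_half)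
    rw [dSnd_geoLift_right hf, sub_zero] at h1
    refine h1.trans (mul_le_mul_of_nonneg_left ?_ hM0)
    have h2 := hle (π / 2 - a) (by linarith [ha.2]) (by linarith)
    rw [Real.sin_pi_div_two_sub] at h2
    rwa [norm_sub_rev, Real.norm_of_nonneg (by linarith [ha.2])]
  · have h1 := hmvt _ (left_mem_Icc.2 neg_le_half)
    rw [dSnd_geoLift_left hf, sub_zero] at h1
    refine h1.trans (mul_le_mul_of_nonneg_left ?_ hM0)
    have h2 := hle (a + π / 2) (by linarith [ha.1]) (by linarith)
    rw [Real.sin_add_pi_div_two] at h2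
    rwa [sub_neg_eq_add, Real.norm_of_nonneg (by linarith [ha.1])]

/-! ### The differential expression in geodesic coordinates -/

/-- The expression with `T_γ (μ^{2γ+1} H) = μ^{2γ+1} · reducedOp γ H`; in the variable `sin α` it
is the Gegenbauer operator of parameter `γ + 1`. -/
def reducedOp (γ : ℝ) (H : ℝ × ℝ → ℂ) (p : ℝ × ℝ) : ℂ :=
  -dSnd (dSnd H) p + ((2 * γ + 2) * Real.tan p.2 : ℝ) * dSnd H p + ((γ + 1) ^ 2 : ℝ) * H p

theorem reducedOp_periodic (γ : ℝ) {f : FanBeam → ℂ} (hf : f ∈ CAlphaPP) (w a : ℝ) :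
    reducedOp γ (geoLift f) (w + 2 * π, a) = reducedOp γ (geoLift f) (w, a) := by
  have h1 := dSnd_periodic (contDiff_geoLift hf) (geoLift_periodic f)
  have h2 := dSnd_periodic (contDiff_dSnd (contDiff_geoLift hf)) h1
  simp only [reducedOp, h1, h2, geoLift_periodic]

theorem reducedOp_neg (γ : ℝ) {f : FanBeam → ℂ} (hf : f ∈ CAlphaPP) (w : ℝ) {a : ℝ}
    (ha : a ∈ Ioo (-(π / 2)) (π / 2)) :
    reducedOp γ (geoLift f) (w + π, -a) = reducedOp γ (geoLift f) (w, a) := by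
  simp only [reducedOp, dSnd_geoLift_neg hf w ha, dSnd_dSnd_geoLift_neg hf w ha,
    geoLift_neg hf w (Ioo_subset_Icc_self ha), Real.tan_neg]
  push_cast
  ring

theorem measurable_reducedOp (γ : ℝ) {H : ℝ × ℝ → ℂ} (hH : ContDiff ℝ ∞ H) :
    Measurable (reducedOp γ H) := by
  have h0 := hH.continuous.measurable
  have h1 := (contDiff_dSnd hH).continuous.measurable
  have h2 := (contDiff_dSnd (contDiff_dSnd hH)).continuous.measurable
  have h3 : Measurable Real.tan := by
    have : Real.tan = fun x => Real.sin x / Real.cos x := funext Real.tan_eq_sin_div_cos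
    rw [this]
    fun_prop
  unfold reducedOp
  fun_prop

theorem exists_norm_reducedOp_le (γ : ℝ) {f : FanBeam → ℂ} (hf : f ∈ CAlphaPP) :
    ∃ C, ∀ w, ∀ a ∈ Icc (-(π / 2)) (π / 2), ‖reducedOp γ (geoLift f) (w, a)‖ ≤ C := by
  have hs := contDiff_geoLift hf
  obtain ⟨C₀, h₀⟩ := exists_norm_le_of_periodic hs.continuous (geoLift_periodic f)
  obtain ⟨C₁, h₁⟩ := exists_norm_dSnd_geoLift_le hf
  obtain ⟨C₂, h₂⟩ := exists_norm_le_of_periodic (contDiff_dSnd (contDiff_dSnd hs)).continuous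
    (dSnd_periodic (contDiff_dSnd hs) (dSnd_periodic hs (geoLift_periodic f)))
  have hπ := Real.pi_pos
  have hC₁ : 0 ≤ C₁ := by
    have := (norm_nonneg _).trans (h₁ 0 0 ⟨by linarith, by linarith⟩)
    simpa using this
  refine ⟨C₂ + |2 * γ + 2| * C₁ + (γ + 1) ^ 2 * C₀, fun w a ha => ?_⟩
  have htan : ‖((2 * γ + 2) * Real.tan a : ℝ) * dSnd (geoLift f) (w, a)‖ ≤ |2 * γ + 2| * C₁ := by
    rw [norm_mul, Complex.norm_real, Real.norm_eq_abs, abs_mul, mul_assoc]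
    refine mul_le_mul_of_nonneg_left ?_ (abs_nonneg _)
    have hcos : 0 ≤ Real.cos a := Real.cos_nonneg_of_mem_Icc ha
    calc |Real.tan a| * ‖dSnd (geoLift f) (w, a)‖
        ≤ |Real.tan a| * (C₁ * Real.cos a) := by gcongr; exact h₁ w a ha
      _ = C₁ * |Real.tan a * Real.cos a| := by rw [abs_mul, abs_of_nonneg hcos]; ring
      _ ≤ C₁ * 1 := by
        gcongr
        rcases hcos.eq_or_lt with h | h
        · simp [← h]
        · rw [Real.tan_mul_cos h.ne']
          exact Real.abs_sin_le_one a
      _ = C₁ := mul_one _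
  refine (norm_add_le _ _).trans (add_le_add ((norm_add_le _ _).trans (add_le_add ?_ htan)) ?_)
  · rw [norm_neg]
    exact h₂ w a ha
  · rw [norm_mul, Complex.norm_real, Real.norm_of_nonneg (sq_nonneg _)]
    exact mul_le_mul_of_nonneg_left (h₀ w a ha) (sq_nonneg _)

/-- In the coordinates `(ω, α)` the vector field `T` is `-∂_α`. -/
theorem vecT_eq {u : FanBeam → ℂ} {U : ℝ × ℝ → ℂ}
    (hu : ∀ b : ℝ, ∀ a ∈ Ioo (-(π / 2)) (π / 2), u ((b : Circ), toAlpha a) = U (b + a, a))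
    (b : ℝ) {a : ℝ} (ha : a ∈ Ioo (-(π / 2)) (π / 2)) (hU : DifferentiableAt ℝ U (b + a, a)) :
    vecT u ((b : Circ), toAlpha a) = -dSnd U (b + a, a) := by
  have hβ : dBeta u ((b : Circ), toAlpha a) = fderiv ℝ U (b + a, a) (1, 0) := by
    have h1 : HasDerivAt (fun s : ℝ => ((b + s + a, a) : ℝ × ℝ)) (1, 0) 0 :=
      (((hasDerivAt_id (0 : ℝ)).const_add b).add_const a).prodMk (hasDerivAt_const _ _)
    have h2 := HasFDerivAt.comp_hasDerivAt (l := U) (l' := fderiv ℝ U (b + a, a)) 0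
      (by simpa using hU.hasFDerivAt) h1
    refine HasDerivAt.deriv (h2.congr_of_eventuallyEq (Filter.Eventually.of_forall fun s => ?_))
    simp only [Function.comp_apply, ← hu (b + s) a ha, AddCircle.coe_add]
  have hα : dAlpha u ((b : Circ), toAlpha a) = fderiv ℝ U (b + a, a) (1, 1) := by
    have h1 : HasDerivAt (fun s : ℝ => ((b + s, s) : ℝ × ℝ)) (1, 1) a :=
      ((hasDerivAt_id a).const_add b).prodMk (hasDerivAt_id a)
    have h2 := HasFDerivAt.comp_hasDerivAt (f := fun s : ℝ => ((b + s, s) : ℝ × ℝ)) a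
      hU.hasFDerivAt h1
    simp only [dAlpha, coe_toAlpha (Ioo_subset_Icc_self ha)]
    exact HasDerivAt.deriv (h2.congr_of_eventuallyEq
      (Filter.eventually_of_mem (isOpen_Ioo.mem_nhds ha) fun t ht => hu b t ht))
  rw [vecT, hβ, hα, ← map_sub, dSnd, ← map_neg]
  simp

theorem exprT_eq (γ : ℝ) {f : FanBeam → ℂ} (hf : f ∈ CAlphaPP) (b : ℝ) {a : ℝ}
    (ha : a ∈ Ioo (-(π / 2)) (π / 2)) :
    exprT γ (muPow (2 * γ + 1) f) ((b : Circ), toAlpha a) =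
      ((Real.cos a ^ (2 * γ + 1) : ℝ) : ℂ) * reducedOp γ (geoLift f) (b + a, a) := by
  have hs := contDiff_geoLift hf
  set H := geoLift f with hH
  have hmu : ∀ (b : ℝ) {t : ℝ}, t ∈ Ioo (-(π / 2)) (π / 2) →
      mu ((b : Circ), toAlpha t) = Real.cos t := fun b t ht => by
    simp only [mu, coe_toAlpha (Ioo_subset_Icc_self ht)]
  have hcos : ∀ {t : ℝ}, t ∈ Ioo (-(π / 2)) (π / 2) → 0 < Real.cos t :=
    fun ht => Real.cos_pos_of_mem_Ioo ht
  have hslice : ∀ (w t : ℝ), HasDerivAt (fun s => H (w, s)) (dSnd H (w, t)) t := fun w t =>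
    hasDerivAt_dSnd (hs.differentiable (by simp) _)
  have hslice' : ∀ (w t : ℝ), HasDerivAt (fun s => dSnd H (w, s)) (dSnd (dSnd H) (w, t)) t :=
    fun w t => hasDerivAt_dSnd ((contDiff_dSnd hs).differentiable (by simp) _)
  -- the first derivative
  have hU : ∀ b : ℝ, ∀ t ∈ Ioo (-(π / 2)) (π / 2), muPow (2 * γ + 1) f ((b : Circ), toAlpha t) =
      (fun p : ℝ × ℝ => ((Real.cos p.2 ^ (2 * γ + 1) : ℝ) : ℂ) * H p) (b + t, t) := by
    intro b t ht
    simp only [muPow, hmu b ht, hH, geoLift_apply f b (Ioo_subset_Icc_self ht)]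
  have hUd : ∀ (w t : ℝ), t ∈ Ioo (-(π / 2)) (π / 2) → DifferentiableAt ℝ
      (fun p : ℝ × ℝ => ((Real.cos p.2 ^ (2 * γ + 1) : ℝ) : ℂ) * H p) (w, t) := by
    intro w t ht
    refine DifferentiableAt.mul ?_ (hs.differentiable (by simp) _)
    refine Complex.ofRealCLM.differentiableAt.comp (w, t) (DifferentiableAt.rpow_const ?_
      (Or.inl (hcos ht).ne'))
    fun_prop
  -- `μ^{-2γ} T (μ^{2γ+1} H)` is smooth up to the boundary
  have hV : ∀ b : ℝ, ∀ t ∈ Ioo (-(π / 2)) (π / 2),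
      muPow (-2 * γ) (vecT (muPow (2 * γ + 1) f)) ((b : Circ), toAlpha t) =
      (fun p : ℝ × ℝ => ((2 * γ + 1 : ℝ) : ℂ) * (Real.sin p.2 : ℝ) * H p
        - (Real.cos p.2 : ℝ) * dSnd H p) (b + t, t) := by
    intro b t ht
    rw [muPow, vecT_eq hU b ht (hUd _ _ ht), hmu b ht]
    have hr : HasDerivAt (fun s => ((Real.cos s ^ (2 * γ + 1) : ℝ) : ℂ))
        ((-Real.sin t * (2 * γ + 1) * Real.cos t ^ (2 * γ + 1 - 1) : ℝ) : ℂ) t :=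
      ((Real.hasDerivAt_cos t).rpow_const (Or.inl (hcos ht).ne')).ofReal_comp
    rw [dSnd_eq_of_hasDerivAt (hUd _ _ ht) (hr.mul (hslice (b + t) t))]
    have e1 : Real.cos t ^ (-2 * γ) * Real.cos t ^ (2 * γ + 1 - 1) = 1 := by
      rw [← Real.rpow_add (hcos ht)]; ring_nf; simp
    have e2 : Real.cos t ^ (-2 * γ) * Real.cos t ^ (2 * γ + 1) = Real.cos t := by
      rw [← Real.rpow_add (hcos ht)]; ring_nf; simp
    have e1' := congrArg (fun x : ℝ => (x : ℂ)) e1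
    have e2' := congrArg (fun x : ℝ => (x : ℂ)) e2
    simp only [Complex.ofReal_mul, Complex.ofReal_one] at e1' e2'
    simp only [Complex.ofReal_mul, Complex.ofReal_neg]
    linear_combination (Real.sin t : ℂ) * ((2 * γ + 1 : ℝ) : ℂ) * H (b + t, t) * e1'
      - dSnd H (b + t, t) * e2'
  have hVd : Differentiable ℝ (fun p : ℝ × ℝ => ((2 * γ + 1 : ℝ) : ℂ) * (Real.sin p.2 : ℝ) * H p
        - (Real.cos p.2 : ℝ) * dSnd H p) := by
    have h1 := hs.differentiable (by simp)
    have h2 := (contDiff_dSnd hs).differentiable (by simp)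
    have h3 : Differentiable ℝ (fun p : ℝ × ℝ => ((Real.sin p.2 : ℝ) : ℂ)) :=
      Complex.ofRealCLM.differentiable.comp (Real.differentiable_sin.comp differentiable_snd)
    have h4 : Differentiable ℝ (fun p : ℝ × ℝ => ((Real.cos p.2 : ℝ) : ℂ)) :=
      Complex.ofRealCLM.differentiable.comp (Real.differentiable_cos.comp differentiable_snd)
    fun_prop
  rw [exprT, muPow, vecT_eq hV b ha (hVd _)]
  have hsin := (Real.hasDerivAt_sin a).ofReal_comp
  have hcosd := (Real.hasDerivAt_cos a).ofReal_comp
  rw [dSnd_eq_of_hasDerivAt (hVd _) (((hsin.const_mul ((2 * γ + 1 : ℝ) : ℂ)).mul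
    (hslice (b + a) a)).sub (hcosd.mul (hslice' (b + a) a)))]
  have hfa : muPow (2 * γ + 1) f ((b : Circ), toAlpha a) =
      ((Real.cos a ^ (2 * γ + 1) : ℝ) : ℂ) * H (b + a, a) := hU b a ha
  rw [hfa, hmu b ha, reducedOp]
  have e1 : Real.cos a ^ (2 * γ) * Real.cos a = Real.cos a ^ (2 * γ + 1) := by
    rw [Real.rpow_add_one (hcos ha).ne']
  have e2 : Real.cos a ^ (2 * γ + 1) * Real.tan a = Real.cos a ^ (2 * γ) * Real.sin a := by
    rw [← e1, mul_assoc, mul_comm (Real.cos a), Real.tan_mul_cos (hcos ha).ne']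
  have e1' := congrArg (fun x : ℝ => (x : ℂ)) e1
  have e2' := congrArg (fun x : ℝ => (x : ℂ)) e2
  simp only [Complex.ofReal_mul] at e1' e2'
  push_cast at e1' e2' ⊢
  linear_combination ((2 * γ + 1) * H (b + a, a) - dSnd (dSnd H) (b + a, a)) * e1'
    - (2 * γ + 2) * dSnd H (b + a, a) * e2'

/-! ### The measures -/

theorem mu_nonneg (p : FanBeam) : 0 ≤ mu p := Real.cos_nonneg_of_mem_Icc p.2.2

theorem mu_le_one (p : FanBeam) : mu p ≤ 1 := Real.cos_le_one _

theorem mu_pos {p : FanBeam} (hp : (p.2 : ℝ) ∈ Ioo (-(π / 2)) (π / 2)) : 0 < mu p :=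
  Real.cos_pos_of_mem_Ioo hp

instance finite_comap :
    IsFiniteMeasure (Measure.comap (Subtype.val : AlphaRange → ℝ) (volume : Measure ℝ)) := by
  refine ⟨?_⟩
  rw [(MeasurableEmbedding.subtype_coe measurableSet_Icc).comap_apply]
  refine (measure_mono (t := Icc (-(π / 2)) (π / 2)) ?_).trans_lt measure_Icc_lt_top
  rintro _ ⟨x, -, rfl⟩
  exact x.2

instance finite_area : IsFiniteMeasure area :=
  inferInstanceAs (IsFiniteMeasure (Measure.prod _ _))

theorem ae_interior : ∀ᵐ p ∂area, (p.2 : ℝ) ∈ Ioo (-(π / 2)) (π / 2) := by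
  have h : ∀ᵐ a : AlphaRange ∂(Measure.comap (Subtype.val : AlphaRange → ℝ) volume),
      (a : ℝ) ∈ Ioo (-(π / 2)) (π / 2) := by
    rw [ae_iff, (MeasurableEmbedding.subtype_coe measurableSet_Icc).comap_apply]
    refine measure_mono_null (t := {-(π / 2), π / 2}) ?_ ((Set.toFinite _).measure_zero _)
    rintro _ ⟨a, ha, rfl⟩
    simp only [mem_ofPred_eq, mem_Ioo, not_and_or, not_lt] at ha
    exact ha.imp (fun h => le_antisymm h a.2.1) fun h => le_antisymm a.2.2 h
  exact Measure.quasiMeasurePreserving_snd.ae h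

theorem measurable_weight (γ : ℝ) :
    Measurable fun p : FanBeam => ENNReal.ofReal (mu p ^ (-2 * γ)) :=
  (measurable_mu.pow_const _).ennreal_ofReal

/-- The weighted measure and the area measure have the same null sets. -/
theorem ae_wMeasure_iff (γ : ℝ) {P : FanBeam → Prop} :
    (∀ᵐ p ∂wMeasure γ, P p) ↔ ∀ᵐ p ∂area, P p := by
  rw [wMeasure, ae_withDensity_iff (measurable_weight γ)]
  refine ⟨fun h => ?_, fun h => h.mono fun p hp _ => hp⟩
  filter_upwards [h, ae_interior] with p hp hi
  refine hp ?_
  rw [Ne, ENNReal.ofReal_eq_zero, not_le]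
  exact Real.rpow_pos_of_pos (mu_pos hi) _

theorem integral_wMeasure (γ : ℝ) (k : FanBeam → ℂ) :
    ∫ p, k p ∂wMeasure γ = ∫ p, ((mu p ^ (-2 * γ) : ℝ) : ℂ) * k p ∂area := by
  rw [wMeasure, integral_withDensity_eq_integral_toReal_smul (measurable_weight γ)
    (Filter.Eventually.of_forall fun _ => ENNReal.ofReal_lt_top)]
  refine integral_congr_ae (Filter.Eventually.of_forall fun p => ?_)
  simp only [ENNReal.toReal_ofReal (Real.rpow_nonneg (mu_nonneg p) _), Complex.real_smul]

theorem measurable_muPow (s : ℝ) {k : FanBeam → ℂ} (hk : Measurable k) :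
    Measurable (muPow s k) := by
  have := measurable_mu.pow_const s
  unfold muPow
  fun_prop

/-- The condition `γ > -1` makes `μ^{2γ+1}` square integrable for the weight `μ^{-2γ}`. -/
theorem memLp_muPow {γ : ℝ} (hγ : -1 < γ) {k : FanBeam → ℂ} (hk : Measurable k) {C : ℝ}
    (hC : ∀ p, ‖k p‖ ≤ C) : MemLp (muPow (2 * γ + 1) k) 2 (wMeasure γ) := by
  have hm := measurable_muPow (2 * γ + 1) hk
  rw [memLp_two_iff_integrable_sq_norm hm.aestronglyMeasurable, wMeasure,
    integrable_withDensity_iff_integrable_smul' (measurable_weight γ)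
      (Filter.Eventually.of_forall fun _ => ENNReal.ofReal_lt_top)]
  refine Integrable.of_bound (C := C ^ 2) ?_ ?_
  · exact ((measurable_weight γ).ennreal_toReal.smul (hm.norm.pow_const 2)).aestronglyMeasurable
  · filter_upwards [ae_interior] with p hp
    have hpos := mu_pos hp
    have e : mu p ^ (-2 * γ) * (mu p ^ (2 * γ + 1)) ^ 2 = mu p ^ (2 * γ + 2) := by
      rw [← Real.rpow_natCast, ← Real.rpow_mul hpos.le, ← Real.rpow_add hpos]
      congr 1
      push_cast
      ring
    rw [ENNReal.toReal_ofReal (Real.rpow_nonneg hpos.le _), muPow, norm_mul, Complex.norm_real,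
      Real.norm_of_nonneg (Real.rpow_nonneg hpos.le _), smul_eq_mul, mul_pow, ← mul_assoc, e,
      Real.norm_of_nonneg (mul_nonneg (Real.rpow_nonneg hpos.le _) (sq_nonneg _))]
    calc mu p ^ (2 * γ + 2) * ‖k p‖ ^ 2 ≤ 1 * C ^ 2 := by
          gcongr
          · exact Real.rpow_le_one hpos.le (mu_le_one p) (by linarith)
          · exact hC p
      _ = C ^ 2 := one_mul _

/-! ### Classes of functions `μ^{2γ+1} k` -/

theorem mem_L2plus_iff {γ : ℝ} {u : L2w γ} :
    u ∈ L2plus γ ↔ (u : FanBeam → ℂ) ∘ scatA =ᵐ[wMeasure γ] u := by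
  have h : (pullA γ u : FanBeam → ℂ) =ᵐ[wMeasure γ] (u : FanBeam → ℂ) ∘ scatA :=
    Lp.coeFn_compMeasurePreserving u (measurePreserving_scatA γ)
  have h' : u ∈ L2plus γ ↔ u = pullA γ u := by
    rw [← sub_eq_zero (a := u)]
    exact LinearMap.mem_ker
  rw [h']
  exact ⟨fun hu => h.symm.trans (Filter.EventuallyEq.of_eq (by rw [← hu])),
    fun hu => Lp.ext (hu.symm.trans h.symm)⟩

/-- The bounded measurable functions that are invariant under `S_A`, except perhaps at the
boundary points `α = ±π/2`. -/
def boundedInvariant : Submodule ℂ (FanBeam → ℂ) where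
  carrier := {k | Measurable k ∧ (∃ C, ∀ p, ‖k p‖ ≤ C) ∧
    ∀ p : FanBeam, (p.2 : ℝ) ∈ Ioo (-(π / 2)) (π / 2) → k (scatA p) = k p}
  add_mem' := by
    rintro k l ⟨hk, ⟨C, hC⟩, hk'⟩ ⟨hl, ⟨D, hD⟩, hl'⟩
    refine ⟨hk.add hl, ⟨C + D, fun p => (norm_add_le _ _).trans (add_le_add (hC p) (hD p))⟩,
      fun p hp => ?_⟩
    simp only [Pi.add_apply, hk' p hp, hl' p hp]
  zero_mem' := ⟨measurable_const, ⟨0, fun p => by simp⟩, fun _ _ => rfl⟩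
  smul_mem' := by
    rintro c k ⟨hk, ⟨C, hC⟩, hk'⟩
    refine ⟨hk.const_smul c, ⟨‖c‖ * C, fun p => ?_⟩, fun p hp => ?_⟩
    · rw [Pi.smul_apply, norm_smul]
      exact mul_le_mul_of_nonneg_left (hC p) (norm_nonneg c)
    · simp only [Pi.smul_apply, hk' p hp]

theorem memLp_of_mem_boundedInvariant {γ : ℝ} (hγ : -1 < γ) (k : boundedInvariant) :
    MemLp (muPow (2 * γ + 1) k) 2 (wMeasure γ) :=
  memLp_muPow hγ k.2.1 k.2.2.1.choose_spec

theorem toLp_mem_L2plus {γ : ℝ} (hγ : -1 < γ) (k : boundedInvariant) :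
    (memLp_of_mem_boundedInvariant hγ k).toLp ∈ L2plus γ := by
  have h := (memLp_of_mem_boundedInvariant hγ k).coeFn_toLp
  rw [mem_L2plus_iff]
  have hi : ∀ᵐ p ∂wMeasure γ, (p.2 : ℝ) ∈ Ioo (-(π / 2)) (π / 2) :=
    (ae_wMeasure_iff γ).2 ae_interior
  filter_upwards [h, (measurePreserving_scatA γ).quasiMeasurePreserving.ae h, hi] with p h1 h2 h3
  rw [Function.comp_apply, h2, h1, muPow, muPow, mu_scatA, k.2.2.2 p h3]

/-- The class of `μ^{2γ+1} k` in `L²₊(∂₊SD, μ^{-2γ})`. -/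
def weightedClass {γ : ℝ} (hγ : -1 < γ) : boundedInvariant →ₗ[ℂ] L2plus γ where
  toFun k := ⟨(memLp_of_mem_boundedInvariant hγ k).toLp, toLp_mem_L2plus hγ k⟩
  map_add' k l := by
    refine Subtype.ext ?_
    refine (MemLp.toLp_congr (memLp_of_mem_boundedInvariant hγ (k + l)) _
      (Filter.EventuallyEq.of_eq ?_)).trans (MemLp.toLp_add (memLp_of_mem_boundedInvariant hγ k)
      (memLp_of_mem_boundedInvariant hγ l))
    funext p
    simp only [muPow, Pi.add_apply, Submodule.coe_add, mul_add]
  map_smul' c k := by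
    refine Subtype.ext ?_
    refine (MemLp.toLp_congr (memLp_of_mem_boundedInvariant hγ (c • k)) _
      (Filter.EventuallyEq.of_eq ?_)).trans
      (MemLp.toLp_const_smul c (memLp_of_mem_boundedInvariant hγ k))
    funext p
    simp only [muPow, Pi.smul_apply, Submodule.coe_smul, smul_eq_mul, mul_left_comm]

theorem weightedClass_ae {γ : ℝ} (hγ : -1 < γ) (k : boundedInvariant) :
    ((weightedClass hγ k : L2w γ) : FanBeam → ℂ) =ᵐ[wMeasure γ] muPow (2 * γ + 1) k :=
  (memLp_of_mem_boundedInvariant hγ k).coeFn_toLp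

theorem inner_weightedClass {γ : ℝ} (hγ : -1 < γ) (u : L2plus γ) (k : boundedInvariant) :
    inner ℂ u (weightedClass hγ k) =
      ∫ p, (starRingEnd ℂ) ((mu p : ℂ) * (u : L2w γ) p) * (k : FanBeam → ℂ) p ∂area := by
  rw [Submodule.coe_inner, L2.inner_def, integral_wMeasure]
  refine integral_congr_ae ?_
  filter_upwards [(ae_wMeasure_iff γ).1 (weightedClass_ae hγ k), ae_interior] with p h hp
  have hpos := mu_pos hp
  have e : mu p ^ (-2 * γ) * mu p ^ (2 * γ + 1) = mu p := by
    rw [← Real.rpow_add hpos]; ring_nf; simp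
  have e' := congrArg (fun x : ℝ => (x : ℂ)) e
  simp only [Complex.ofReal_mul] at e'
  rw [h, RCLike.inner_apply, muPow, map_mul, Complex.conj_ofReal]
  linear_combination (starRingEnd ℂ ((u : L2w γ) p)) * (k : FanBeam → ℂ) p * e'

theorem inner_weightedClass_weightedClass {γ : ℝ} (hγ : -1 < γ) (k l : boundedInvariant) :
    inner ℂ (weightedClass hγ k) (weightedClass hγ l) =
      ∫ p, ((mu p ^ (2 * γ + 2) : ℝ) : ℂ) *
        ((starRingEnd ℂ) ((k : FanBeam → ℂ) p) * (l : FanBeam → ℂ) p) ∂area := by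
  rw [inner_weightedClass]
  refine integral_congr_ae ?_
  filter_upwards [(ae_wMeasure_iff γ).1 (weightedClass_ae hγ k), ae_interior] with p h hp
  have hpos := mu_pos hp
  have e : mu p * mu p ^ (2 * γ + 1) = mu p ^ (2 * γ + 2) := by
    rw [← Real.rpow_one_add' hpos.le (by linarith)]; ring_nf
  rw [h, muPow, ← e, map_mul, map_mul, Complex.conj_ofReal, Complex.conj_ofReal]
  push_cast
  ring

/-! ### From functions on the universal cover to functions on `∂₊SD` -/

/-- The function on `∂₊SD` whose expression in the coordinates `(β + α, α)` is `H`, provided that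
`H` is `2π`-periodic in the first variable. -/
def descend (H : ℝ × ℝ → ℂ) (p : FanBeam) : ℂ :=
  H ((AddCircle.equivIco (2 * π) 0 p.1 : ℝ) + p.2, p.2)

theorem descend_coe {H : ℝ × ℝ → ℂ} (hper : ∀ w a, H (w + 2 * π, a) = H (w, a)) (b : ℝ)
    (a : AlphaRange) : descend H ((b : Circ), a) = H (b + a, a) := by
  have hp : Function.Periodic (fun w => H (w + a, a)) (2 * π) := fun w => by
    simp only [add_right_comm w, hper]
  have h := congrArg hp.lift (AddCircle.coe_equivIco (p := 2 * π) (a := 0) (y := (b : Circ)))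
  simp only [Function.Periodic.lift_coe] at h
  exact h

theorem measurable_descend {H : ℝ × ℝ → ℂ} (hH : Measurable H) : Measurable (descend H) := by
  have h1 : Measurable fun x : Circ => (AddCircle.equivIco (2 * π) 0 x : ℝ) :=
    measurable_subtype_coe.comp (AddCircle.measurableEquivIco (2 * π) 0).measurable
  have h2 : Measurable fun p : FanBeam => (p.2 : ℝ) := measurable_subtype_coe.comp measurable_snd
  exact hH.comp (((h1.comp measurable_fst).add h2).prodMk h2)

theorem descend_geoLift (f : FanBeam → ℂ) : descend (geoLift f) = f := by
  funext ⟨x, a⟩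
  induction x using QuotientAddGroup.induction_on with
  | H b =>
    exact (descend_coe (geoLift_periodic f) b a).trans
      ((geoLift_apply f b a.2).trans (by rw [toAlpha_coe]))

theorem descend_mem_boundedInvariant {H : ℝ × ℝ → ℂ} (hH : Measurable H)
    (hper : ∀ w a, H (w + 2 * π, a) = H (w, a))
    (hC : ∃ C, ∀ w, ∀ a ∈ Icc (-(π / 2)) (π / 2), ‖H (w, a)‖ ≤ C)
    (hinv : ∀ w, ∀ a ∈ Ioo (-(π / 2)) (π / 2), H (w + π, -a) = H (w, a)) :
    descend H ∈ boundedInvariant := by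
  refine ⟨measurable_descend hH, hC.imp fun C h p => h _ _ p.2.2, ?_⟩
  rintro ⟨x, a⟩ ha
  induction x using QuotientAddGroup.induction_on with
  | H b =>
    have h1 : scatA ((b : Circ), a) = (((b + (π + 2 * a) : ℝ) : Circ), (scatA ((b : Circ), a)).2) :=
      Prod.ext (by simp only [scatA, AddCircle.coe_add]) rfl
    have h2 : (((scatA ((b : Circ), a)).2 : AlphaRange) : ℝ) = -a := rfl
    change descend H (scatA ((b : Circ), a)) = descend H ((b : Circ), a)
    rw [h1, descend_coe hper, descend_coe hper, h2, ← hinv _ _ ha]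
    congr 2
    ring

/-! ### The two maps whose graph is the operator -/

theorem evenExt_add (f g : FanBeam → ℂ) : evenExt (f + g) = evenExt f + evenExt g := by
  funext p
  simp only [evenExt, Pi.add_apply]
  split_ifs <;> rfl

theorem evenExt_smul (c : ℂ) (f : FanBeam → ℂ) : evenExt (c • f) = c • evenExt f := by
  funext p
  simp only [evenExt, Pi.smul_apply]
  split_ifs <;> rfl

/-- The space `C^∞_{α,+,+}(∂₊SD)` as a linear subspace. -/
def smoothSpace : Submodule ℂ (FanBeam → ℂ) where
  carrier := CAlphaPP
  add_mem' := by
    rintro f g ⟨h1, h2, h3⟩ ⟨h1', h2', h3'⟩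
    refine ⟨h1.add h1', ?_, fun p => by simp only [Pi.add_apply, h3, h3']⟩
    rw [evenExt_add]
    exact h2.add h2'
  zero_mem' := by
    refine ⟨contDiffOn_const, ?_, fun p => rfl⟩
    have : evenExt 0 = fun _ => 0 := by
      funext p
      simp [evenExt]
    rw [this]
    exact contDiff_const
  smul_mem' := by
    rintro c f ⟨h1, h2, h3⟩
    refine ⟨h1.const_smul c, ?_, fun p => by simp only [Pi.smul_apply, h3]⟩
    rw [evenExt_smul]
    exact h2.const_smul c

theorem geoLift_add (f g : FanBeam → ℂ) : geoLift (f + g) = geoLift f + geoLift g := by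
  funext p
  simp only [geoLift, evenExt_add, Pi.add_apply]

theorem geoLift_smul (c : ℂ) (f : FanBeam → ℂ) : geoLift (c • f) = c • geoLift f := by
  funext p
  simp only [geoLift, evenExt_smul, Pi.smul_apply]

theorem dSnd_add {H G : ℝ × ℝ → ℂ} (hH : ContDiff ℝ ∞ H) (hG : ContDiff ℝ ∞ G) :
    dSnd (H + G) = dSnd H + dSnd G := by
  funext p
  simp only [dSnd, Pi.add_apply, fderiv_add (hH.differentiable (by simp) p)
    (hG.differentiable (by simp) p), add_apply]

theorem dSnd_smul (c : ℂ) {H : ℝ × ℝ → ℂ} (hH : ContDiff ℝ ∞ H) :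
    dSnd (c • H) = c • dSnd H := by
  funext p
  simp only [dSnd, Pi.smul_apply, fderiv_const_smul (hH.differentiable (by simp) p),
    smul_apply]

theorem reducedOp_add (γ : ℝ) {H G : ℝ × ℝ → ℂ} (hH : ContDiff ℝ ∞ H) (hG : ContDiff ℝ ∞ G) :
    reducedOp γ (H + G) = reducedOp γ H + reducedOp γ G := by
  funext p
  simp only [reducedOp, dSnd_add hH hG, dSnd_add (contDiff_dSnd hH) (contDiff_dSnd hG),
    Pi.add_apply]
  ring

theorem reducedOp_smul (γ : ℝ) (c : ℂ) {H : ℝ × ℝ → ℂ} (hH : ContDiff ℝ ∞ H) :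
    reducedOp γ (c • H) = c • reducedOp γ H := by
  funext p
  simp only [reducedOp, dSnd_smul c hH, dSnd_smul c (contDiff_dSnd hH), Pi.smul_apply,
    smul_eq_mul]
  ring

theorem smoothSpace_le : smoothSpace ≤ boundedInvariant := by
  intro f hf
  rw [← descend_geoLift f]
  have hs := (contDiff_geoLift hf).continuous
  exact descend_mem_boundedInvariant hs.measurable (geoLift_periodic f)
    (exists_norm_le_of_periodic hs (geoLift_periodic f))
    fun w _ ha => geoLift_neg hf w (Ioo_subset_Icc_self ha)

/-- The map `f ↦ μ^{-2γ-1} T_γ (μ^{2γ+1} f)`. -/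
def reducedMap (γ : ℝ) : smoothSpace →ₗ[ℂ] boundedInvariant where
  toFun f := ⟨descend (reducedOp γ (geoLift f)),
    descend_mem_boundedInvariant (measurable_reducedOp γ (contDiff_geoLift f.2))
      (reducedOp_periodic γ f.2) (exists_norm_reducedOp_le γ f.2)
      fun w _ ha => reducedOp_neg γ f.2 w ha⟩
  map_add' f g := by
    refine Subtype.ext ?_
    simp only [Submodule.coe_add, geoLift_add,
      reducedOp_add γ (contDiff_geoLift f.2) (contDiff_geoLift g.2)]
    rfl
  map_smul' c f := by
    refine Subtype.ext ?_
    simp only [Submodule.coe_smul, geoLift_smul, reducedOp_smul γ c (contDiff_geoLift f.2)]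
    rfl

theorem reducedMap_apply (γ : ℝ) (f : smoothSpace) :
    (reducedMap γ f : FanBeam → ℂ) = descend (reducedOp γ (geoLift f)) := rfl

/-- The differential expression on `μ^{2γ+1} f`, off the boundary `α = ±π/2`. -/
theorem exprT_ae (γ : ℝ) (f : smoothSpace) :
    exprT γ (muPow (2 * γ + 1) f) =ᵐ[wMeasure γ] muPow (2 * γ + 1) (reducedMap γ f) := by
  refine (ae_wMeasure_iff γ).2 ?_
  filter_upwards [ae_interior]
  rintro ⟨x, a⟩ ha
  induction x using QuotientAddGroup.induction_on with
  | H b =>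
    have h := exprT_eq γ f.2 b ha
    rw [toAlpha_coe] at h
    refine h.trans ?_
    rw [muPow, reducedMap_apply]
    congr 1
    exact (descend_coe (reducedOp_periodic γ f.2) b a).symm

/-- The map `f ↦ μ^{2γ+1} f` onto the domain of the operator. -/
def domainMap {γ : ℝ} (hγ : -1 < γ) : smoothSpace →ₗ[ℂ] L2plus γ :=
  weightedClass hγ ∘ₗ Submodule.inclusion smoothSpace_le

/-- The map `f ↦ T_γ (μ^{2γ+1} f)`. -/
def valueMap {γ : ℝ} (hγ : -1 < γ) : smoothSpace →ₗ[ℂ] L2plus γ :=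
  weightedClass hγ ∘ₗ reducedMap γ

/-! ### Symmetry -/

/-- Lagrange's identity on a geodesic. The boundary terms carry the factor `μ^{2γ+2}`, which
vanishes at both ends because `γ > -1`. -/
theorem integral_lagrange {γ : ℝ} (hγ : -1 < γ) {f g : FanBeam → ℂ} (hf : f ∈ CAlphaPP)
    (hg : g ∈ CAlphaPP) (w : ℝ) :
    ∫ a in Icc (-(π / 2)) (π / 2), ((Real.cos a ^ (2 * γ + 2) : ℝ) : ℂ) *
      ((starRingEnd ℂ) (reducedOp γ (geoLift f) (w, a)) * geoLift g (w, a) -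
        (starRingEnd ℂ) (geoLift f (w, a)) * reducedOp γ (geoLift g) (w, a)) = 0 := by
  have hF := contDiff_geoLift hf
  have hG := contDiff_geoLift hg
  obtain ⟨C₁, h₁⟩ := exists_norm_reducedOp_le γ hf
  obtain ⟨C₂, h₂⟩ := exists_norm_le_of_periodic hG.continuous (geoLift_periodic g)
  obtain ⟨C₃, h₃⟩ := exists_norm_le_of_periodic hF.continuous (geoLift_periodic f)
  obtain ⟨C₄, h₄⟩ := exists_norm_reducedOp_le γ hg
  have m₁ := measurable_reducedOp γ hF
  have m₂ := hG.continuous.measurable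
  have m₃ := hF.continuous.measurable
  have m₄ := measurable_reducedOp γ hG
  set F := geoLift f
  set G := geoLift g
  have hexp : 0 < 2 * γ + 2 := by linarith
  let Φ : ℝ → ℂ := fun a => ((Real.cos a ^ (2 * γ + 2) : ℝ) : ℂ) *
    ((starRingEnd ℂ) (F (w, a)) * dSnd G (w, a) - (starRingEnd ℂ) (dSnd F (w, a)) * G (w, a))
  have hcont : Continuous Φ := by
    have c1 : Continuous fun a : ℝ => Real.cos a ^ (2 * γ + 2) :=
      Real.continuous_cos.rpow_const fun _ => Or.inr hexp.le
    have c2 := hF.continuous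
    have c3 := hG.continuous
    have c4 := (contDiff_dSnd hF).continuous
    have c5 := (contDiff_dSnd hG).continuous
    have c6 : Continuous (starRingEnd ℂ) := Complex.continuous_conj
    exact (Complex.continuous_ofReal.comp c1).mul (((c6.comp (c2.comp (by fun_prop))).mul
      (c5.comp (by fun_prop))).sub ((c6.comp (c4.comp (by fun_prop))).mul (c3.comp (by fun_prop))))
  rw [integral_Icc_eq_integral_Ioc, ← intervalIntegral.integral_of_le neg_le_half]
  rw [intervalIntegral.integral_eq_sub_of_hasDerivAt_of_le (f := Φ) neg_le_half
    hcont.continuousOn]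
  · simp [Φ, Real.zero_rpow hexp.ne']
  · intro a ha
    have hc := Real.cos_pos_of_mem_Ioo ha
    have d0 : HasDerivAt (fun s => ((Real.cos s ^ (2 * γ + 2) : ℝ) : ℂ))
        ((-Real.sin a * (2 * γ + 2) * Real.cos a ^ (2 * γ + 2 - 1) : ℝ) : ℂ) a :=
      ((Real.hasDerivAt_cos a).rpow_const (Or.inl hc.ne')).ofReal_comp
    have dF := hasDerivAt_dSnd (hF.differentiable (by simp) (w, a))
    have dG := hasDerivAt_dSnd (hG.differentiable (by simp) (w, a))
    have dF' := hasDerivAt_dSnd ((contDiff_dSnd hF).differentiable (by simp) (w, a))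
    have dG' := hasDerivAt_dSnd ((contDiff_dSnd hG).differentiable (by simp) (w, a))
    have dW : HasDerivAt
        (fun s => star (F (w, s)) * dSnd G (w, s) - star (dSnd F (w, s)) * G (w, s)) _ a :=
         (dF.star.mul dG').sub (dF'.star.mul dG)
    refine (d0.mul dW).congr_deriv ?_
    have e : Real.cos a ^ (2 * γ + 2 - 1) * Real.sin a =
        Real.cos a ^ (2 * γ + 2) * Real.tan a := by
      rw [Real.rpow_sub_one hc.ne', Real.tan_eq_sin_div_cos]
      ring
    have e' := congrArg (fun x : ℝ => (x : ℂ)) e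
    simp only [Complex.ofReal_mul] at e'
    simp only [reducedOp, map_add, map_neg, map_mul, Complex.conj_ofReal]
    simp only [starRingEnd_apply]
    push_cast at e' ⊢
    linear_combination -(2 * γ + 2) * (star (F (w, a)) * dSnd G (w, a)
      - star (dSnd F (w, a)) * G (w, a)) * e'
  · rw [intervalIntegrable_iff_integrableOn_Ioc_of_le neg_le_half]
    refine Measure.integrableOn_of_bounded (M := 1 * (C₁ * C₂ + C₃ * C₄)) (by simp) ?_ ?_
    · have mc : Measurable (starRingEnd ℂ) := Complex.continuous_conj.measurable
      refine Measurable.aestronglyMeasurable ?_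
      have hpair : Measurable fun a : ℝ => (w, a) := measurable_prodMk_left
      exact (Complex.measurable_ofReal.comp (Real.measurable_cos.pow_const _)).mul
        (((mc.comp (m₁.comp hpair)).mul (m₂.comp hpair)).sub
          ((mc.comp (m₃.comp hpair)).mul (m₄.comp hpair)))
    · filter_upwards [ae_restrict_mem measurableSet_Ioc] with a ha
      have ha' := Ioc_subset_Icc_self ha
      have hc := Real.cos_nonneg_of_mem_Icc ha'
      have hC₁ := (norm_nonneg _).trans (h₁ w a ha')
      have hC₃ := (norm_nonneg _).trans (h₃ w a ha')
      rw [norm_mul, Complex.norm_real, Real.norm_of_nonneg (Real.rpow_nonneg hc _)]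
      refine mul_le_mul (Real.rpow_le_one hc (Real.cos_le_one a) hexp.le) ?_ (norm_nonneg _)
        zero_le_one
      refine (norm_sub_le _ _).trans ?_
      rw [norm_mul, norm_mul, RCLike.norm_conj, RCLike.norm_conj]
      exact add_le_add (mul_le_mul (h₁ w a ha') (h₂ w a ha') (norm_nonneg _) hC₁)
        (mul_le_mul (h₃ w a ha') (h₄ w a ha') (norm_nonneg _) hC₃)

/-- The change of coordinates `(ω, α) ↦ (ω - α, α)` preserves the area. -/
theorem measurePreserving_shear :
    MeasurePreserving (fun p : FanBeam => (p.1 - ((p.2 : ℝ) : Circ), p.2)) area area := by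
  have h1 := (MeasurePreserving.id
      (Measure.comap (Subtype.val : AlphaRange → ℝ) volume)).skew_product
    (μc := (volume : Measure Circ)) (μd := (volume : Measure Circ))
    (g := fun a b => b - ((a : ℝ) : Circ)) (by
      refine Continuous.measurable ?_
      refine continuous_snd.sub ((AddCircle.continuous_mk' (2 * π)).comp ?_)
      fun_prop)
    (Filter.Eventually.of_forall fun a => (measurePreserving_sub_right volume _).map_eq)
  exact (Measure.measurePreserving_swap.comp h1).comp Measure.measurePreserving_swap

/-- An integral over `∂₊SD` vanishes if the integral along every geodesic does. -/
theorem integral_area_eq_zero {k : FanBeam → ℂ} (hk : Integrable k area)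
    (h : ∀ w : ℝ, ∫ a in Icc (-(π / 2)) (π / 2), k (((w - a : ℝ) : Circ), toAlpha a) = 0) :
    ∫ p, k p ∂area = 0 := by
  have hs := measurePreserving_shear
  have hm : AEStronglyMeasurable k
      (Measure.map (fun p : FanBeam => (p.1 - ((p.2 : ℝ) : Circ), p.2)) area) := by
    rw [hs.map_eq]
    exact hk.aestronglyMeasurable
  rw [← hs.map_eq, integral_map hs.measurable.aemeasurable hm]
  have hi := hs.integrable_comp_of_integrable hk
  rw [area] at hi ⊢
  refine (integral_prod _ hi).trans ?_
  refine integral_eq_zero_of_ae (Filter.Eventually.of_forall fun x => ?_)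
  induction x using QuotientAddGroup.induction_on with
  | H w =>
    refine Eq.trans ?_ (h w)
    rw [← integral_subtype_comap measurableSet_Icc
      (fun a : ℝ => k (((w - a : ℝ) : Circ), toAlpha a))]
    refine integral_congr_ae (Filter.Eventually.of_forall fun a => ?_)
    simp only [toAlpha_coe]
    rfl

theorem integrable_weighted {γ : ℝ} (hγ : -1 < γ) (k l : boundedInvariant) :
    Integrable (fun p => ((mu p ^ (2 * γ + 2) : ℝ) : ℂ) *
      ((starRingEnd ℂ) ((k : FanBeam → ℂ) p) * (l : FanBeam → ℂ) p)) area := by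
  obtain ⟨hk, ⟨C, hC⟩, -⟩ := k.2
  obtain ⟨hl, ⟨D, hD⟩, -⟩ := l.2
  refine Integrable.of_bound (C := 1 * (C * D)) (Measurable.aestronglyMeasurable ?_)
    (Filter.Eventually.of_forall fun p => ?_)
  · exact (Complex.measurable_ofReal.comp (measurable_mu.pow_const _)).mul
      ((Complex.continuous_conj.measurable.comp hk).mul hl)
  · have hC0 := (norm_nonneg _).trans (hC p)
    rw [norm_mul, norm_mul, RCLike.norm_conj, Complex.norm_real,
      Real.norm_of_nonneg (Real.rpow_nonneg (mu_nonneg p) _)]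
    exact mul_le_mul (Real.rpow_le_one (mu_nonneg p) (mu_le_one p) (by linarith))
      (mul_le_mul (hC p) (hD p) (norm_nonneg _) hC0) (by positivity) zero_le_one

theorem inner_valueMap_domainMap {γ : ℝ} (hγ : -1 < γ) (f g : smoothSpace) :
    inner ℂ (valueMap hγ f) (domainMap hγ g) = inner ℂ (domainMap hγ f) (valueMap hγ g) := by
  have hi₁ := integrable_weighted hγ (reducedMap γ f) (Submodule.inclusion smoothSpace_le g)
  have hi₂ := integrable_weighted hγ (Submodule.inclusion smoothSpace_le f) (reducedMap γ g)
  simp only [valueMap, domainMap, LinearMap.comp_apply]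
  rw [inner_weightedClass_weightedClass, inner_weightedClass_weightedClass, ← sub_eq_zero,
    ← integral_sub hi₁ hi₂]
  refine integral_area_eq_zero (hi₁.sub hi₂) fun w => ?_
  rw [← integral_lagrange hγ f.2 g.2 w]
  refine setIntegral_congr_fun measurableSet_Icc fun a ha => ?_
  have hα : (toAlpha a : ℝ) = a := coe_toAlpha ha
  have hred : ∀ h : smoothSpace, (reducedMap γ h : FanBeam → ℂ) (((w - a : ℝ) : Circ), toAlpha a)
      = reducedOp γ (geoLift h) (w, a) := fun h => by
    rw [reducedMap_apply, descend_coe (reducedOp_periodic γ h.2), hα, sub_add_cancel]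
  have hincl : ∀ h : smoothSpace,
      (Submodule.inclusion smoothSpace_le h : FanBeam → ℂ) (((w - a : ℝ) : Circ), toAlpha a)
      = geoLift h (w, a) := fun h => by
    have := geoLift_apply (h : FanBeam → ℂ) (w - a) ha
    rw [sub_add_cancel] at this
    exact this.symm
  have hmu : mu (((w - a : ℝ) : Circ), toAlpha a) = Real.cos a := by rw [mu, hα]
  simp only [hred, hincl, hmu]
  ring

/-! ### The functions `(sin α)^n e^{ik(β + α)}` -/

/-- The function `(sin α)^n e^{ik(β + α)}` on `∂₊SD`. -/
def monomial (n : ℕ) (k : ℤ) : C(FanBeam, ℂ) where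
  toFun p := ((Real.sin p.2 : ℝ) : ℂ) ^ n * fourier k (p.1 + ((p.2 : ℝ) : Circ))
  continuous_toFun := by
    refine ((Complex.continuous_ofReal.comp (Real.continuous_sin.comp
      (continuous_subtype_val.comp continuous_snd))).pow n).mul ((fourier k).continuous.comp ?_)
    refine continuous_fst.add ((AddCircle.continuous_mk' (2 * π)).comp ?_)
    fun_prop

theorem monomial_apply (n : ℕ) (k : ℤ) (p : FanBeam) :
    monomial n k p = ((Real.sin p.2 : ℝ) : ℂ) ^ n * fourier k (p.1 + ((p.2 : ℝ) : Circ)) := rfl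

theorem monomial_mul (n m : ℕ) (k l : ℤ) :
    monomial n k * monomial m l = monomial (n + m) (k + l) := by
  ext p
  simp only [ContinuousMap.mul_apply, monomial_apply, fourier_add, pow_add]
  ring

theorem fourier_add_right (k : ℤ) (x y : Circ) :
    fourier k (x + y) = fourier k x * fourier k y := by
  simp only [fourier_apply, smul_add, AddCircle.toCircle_add, Circle.coe_mul]

theorem fourier_pi (k : ℤ) : fourier k ((π : ℝ) : Circ) = (-1 : ℂ) ^ k := by
  have hπ : (π : ℂ) ≠ 0 := Complex.ofReal_ne_zero.2 Real.pi_ne_zero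
  rw [fourier_coe_apply, ← Complex.exp_pi_mul_I, ← Complex.exp_int_mul]
  congr 1
  push_cast
  field_simp

theorem monomial_scatA (n : ℕ) (k : ℤ) (p : FanBeam) :
    monomial n k (scatA p) = (-1) ^ ((n : ℤ) + k) * monomial n k p := by
  have h : (scatA p).1 + (((scatA p).2 : ℝ) : Circ) =
      (p.1 + ((p.2 : ℝ) : Circ)) + ((π : ℝ) : Circ) := by
    simp only [scatA]
    rw [add_assoc, add_assoc, ← AddCircle.coe_add, ← AddCircle.coe_add]
    congr 2
    ring
  have h2 : ((scatA p).2 : ℝ) = -p.2 := rfl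
  rw [monomial_apply, monomial_apply, h, h2, fourier_add_right, fourier_pi, Real.sin_neg,
    zpow_add₀ (by norm_num), zpow_natCast]
  push_cast
  rw [neg_pow]
  ring

theorem contDiff_fourier (k : ℤ) : ContDiff ℝ ∞ fun x : ℝ => fourier k (x : Circ) := by
  simp only [fourier_coe_apply]
  have h : ContDiff ℝ ∞ fun x : ℝ => (x : ℂ) := Complex.ofRealCLM.contDiff
  exact ((contDiff_const.mul h).div_const _).cexp

theorem contDiff_ofReal_sin : ContDiff ℝ ∞ fun x : ℝ => ((Real.sin x : ℝ) : ℂ) :=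
  Complex.ofRealCLM.contDiff.comp Real.contDiff_sin

theorem evenExt_monomial (n : ℕ) (k : ℤ) (x : Circ) (a : ℝ) :
    evenExt (monomial n k) (x, (a : Circ)) =
      ((Real.sin a : ℝ) : ℂ) ^ n * fourier k (x + (a : Circ)) := by
  -- it is enough to treat the representative of `a` that `evenExt` uses
  set c := AddCircle.equivIco (2 * π) (-(π / 2)) (a : Circ) with hc
  have hca : ((c : ℝ) : Circ) = (a : Circ) := AddCircle.coe_equivIco
  have hsin : Real.sin a = Real.sin c := by
    have h := congrArg Real.sin_periodic.lift hca
    simp only [Function.Periodic.lift_coe] at h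
    exact h.symm
  rw [← hca, hsin, evenExt_coe x c.2]
  split_ifs with h
  · rw [monomial_apply, coe_toAlpha ⟨c.2.1, h⟩]
  · have h' : π - (c : ℝ) ∈ Icc (-(π / 2)) (π / 2) :=
      ⟨by linarith [c.2.2], by linarith [not_le.1 h]⟩
    rw [monomial_apply, coe_toAlpha h', Real.sin_pi_sub]
    congr 2
    rw [add_assoc, ← AddCircle.coe_add, ← AddCircle.coe_add_period (2 * π) (c : ℝ)]
    congr 2
    ring

theorem geoLift_monomial (n : ℕ) (k : ℤ) (w a : ℝ) :
    geoLift (monomial n k) (w, a) = ((Real.sin a : ℝ) : ℂ) ^ n * fourier k (w : Circ) := by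
  rw [geoLift, evenExt_monomial, ← AddCircle.coe_add, sub_add_cancel]

theorem monomial_mem {n : ℕ} {k : ℤ} (h : Even ((n : ℤ) + k)) :
    (monomial n k : FanBeam → ℂ) ∈ smoothSpace := by
  have hs : ContDiff ℝ ∞ fun p : ℝ × ℝ =>
      ((Real.sin p.2 : ℝ) : ℂ) ^ n * fourier k ((p.1 + p.2 : ℝ) : Circ) :=
    ((contDiff_ofReal_sin.comp contDiff_snd).pow n).mul
      ((contDiff_fourier k).comp (contDiff_fst.add contDiff_snd))
  refine ⟨hs.contDiffOn.congr fun p hp => ?_, ?_, fun p => ?_⟩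
  · rw [monomial_apply, coe_toAlpha hp.2, AddCircle.coe_add]
  · simp only [SmoothOnTorus, evenExt_monomial, ← AddCircle.coe_add]
    exact hs
  · rw [monomial_scatA, h.neg_one_zpow, one_mul]

/-- The functions `(sin α)^n e^{ik(β + α)}` with `n + k` even, which are those invariant
under `S_A`. -/
def evenMonomial (n : ℕ) (k : ℤ) (h : Even ((n : ℤ) + k)) : smoothSpace :=
  ⟨monomial n k, monomial_mem h⟩

theorem dSnd_sin_pow (n : ℕ) (c : ℝ → ℂ) {H : ℝ × ℝ → ℂ} (hH : ContDiff ℝ ∞ H)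
    (h : ∀ w a, H (w, a) = ((Real.sin a : ℝ) : ℂ) ^ n * c w) (w a : ℝ) :
    dSnd H (w, a) = n * ((Real.sin a : ℝ) : ℂ) ^ (n - 1) * (Real.cos a : ℝ) * c w := by
  refine dSnd_eq_of_hasDerivAt (hH.differentiable (by simp) _) ?_
  simp only [h]
  exact ((Real.hasDerivAt_sin a).ofReal_comp.pow n).mul_const (c w)

/-- On the powers of `sin α` the reduced operator is triangular, with the Gegenbauer eigenvalues
`(n + γ + 1)²` on the diagonal. -/
theorem reducedOp_monomial (γ : ℝ) {n : ℕ} {k : ℤ} (h : Even ((n : ℤ) + k)) (w : ℝ) {a : ℝ}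
    (ha : a ∈ Ioo (-(π / 2)) (π / 2)) :
    reducedOp γ (geoLift (monomial n k)) (w, a) =
      (((n + γ + 1) ^ 2 : ℝ) : ℂ) * geoLift (monomial n k) (w, a) -
        (n * (n - 1) : ℂ) * geoLift (monomial (n - 2) k) (w, a) := by
  have hs := contDiff_geoLift (monomial_mem h)
  have h1 := dSnd_sin_pow n (fun w => fourier k (w : Circ)) hs (geoLift_monomial n k)
  have h2 : dSnd (dSnd (geoLift (monomial n k))) (w, a) =
      (n * (((n - 1 : ℕ) : ℂ) * ((Real.sin a : ℝ) : ℂ) ^ (n - 1 - 1) * (Real.cos a : ℝ)) *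
        (Real.cos a : ℝ) + n * ((Real.sin a : ℝ) : ℂ) ^ (n - 1) * (-Real.sin a : ℝ)) *
        fourier k (w : Circ) := by
    refine dSnd_eq_of_hasDerivAt ((contDiff_dSnd hs).differentiable (by simp) _) ?_
    simp only [h1]
    exact ((((Real.hasDerivAt_sin a).ofReal_comp.pow (n - 1)).const_mul (n : ℂ)).mul
      (Real.hasDerivAt_cos a).ofReal_comp).mul_const _
  have htan : ((Real.tan a : ℝ) : ℂ) * ((Real.cos a : ℝ) : ℂ) = ((Real.sin a : ℝ) : ℂ) := by
    rw [← Complex.ofReal_mul, Real.tan_mul_cos (Real.cos_pos_of_mem_Ioo ha).ne']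
  have hsq : ((Real.sin a : ℝ) : ℂ) ^ 2 + ((Real.cos a : ℝ) : ℂ) ^ 2 = 1 := by
    rw [← Complex.ofReal_pow, ← Complex.ofReal_pow, ← Complex.ofReal_add, Real.sin_sq_add_cos_sq,
      Complex.ofReal_one]
  rw [reducedOp, h1, h2, geoLift_monomial, geoLift_monomial]
  simp only [Complex.ofReal_mul, Complex.ofReal_neg]
  generalize ((Real.tan a : ℝ) : ℂ) = t at *
  generalize ((Real.cos a : ℝ) : ℂ) = c at *
  generalize ((Real.sin a : ℝ) : ℂ) = s at *
  generalize (fourier k (w : Circ) : ℂ) = e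
  match n with
  | 0 =>
    push_cast
    ring
  | 1 =>
    push_cast
    simp only [pow_zero]
    linear_combination (2 * γ + 2) * e * htan
  | n + 2 =>
    simp only [Nat.add_sub_cancel, show n + 2 - 1 = n + 1 from rfl, pow_succ]
    push_cast
    linear_combination (2 * γ + 2) * (n + 2) * s ^ n * s * e * htan
      - (n + 2) * (n + 1) * s ^ n * e * hsq

theorem weightedClass_congr {γ : ℝ} (hγ : -1 < γ) {k l : boundedInvariant}
    (h : ∀ p : FanBeam, (p.2 : ℝ) ∈ Ioo (-(π / 2)) (π / 2) →
      (k : FanBeam → ℂ) p = (l : FanBeam → ℂ) p) : weightedClass hγ k = weightedClass hγ l := by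
  refine Subtype.ext (Lp.ext ?_)
  filter_upwards [weightedClass_ae hγ k, weightedClass_ae hγ l,
    (ae_wMeasure_iff γ).2 ae_interior] with p h1 h2 h3
  rw [h1, h2, muPow, muPow, h p h3]

theorem reducedMap_evenMonomial (γ : ℝ) {n : ℕ} {k : ℤ} (h : Even ((n : ℤ) + k)) {p : FanBeam}
    (hp : (p.2 : ℝ) ∈ Ioo (-(π / 2)) (π / 2)) :
    (reducedMap γ (evenMonomial n k h) : FanBeam → ℂ) p =
      (((n + γ + 1) ^ 2 : ℝ) : ℂ) * monomial n k p - (n * (n - 1) : ℂ) * monomial (n - 2) k p := by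
  rw [← congrFun (descend_geoLift (monomial n k)) p,
    ← congrFun (descend_geoLift (monomial (n - 2) k)) p]
  exact reducedOp_monomial γ h _ hp

theorem valueMap_evenMonomial_of_lt_two {γ : ℝ} (hγ : -1 < γ) {n : ℕ} (hn : n < 2) {k : ℤ}
    (h : Even ((n : ℤ) + k)) : valueMap hγ (evenMonomial n k h) =
      (((n + γ + 1) ^ 2 : ℝ) : ℂ) • domainMap hγ (evenMonomial n k h) := by
  simp only [valueMap, domainMap, LinearMap.comp_apply, ← map_smul]
  refine weightedClass_congr hγ fun p hp => ?_
  have h0 : (n * (n - 1) : ℂ) = 0 := by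
    interval_cases n <;> simp
  rw [reducedMap_evenMonomial γ h hp, h0, zero_mul, sub_zero]
  rfl

theorem valueMap_evenMonomial_add_two {γ : ℝ} (hγ : -1 < γ) {n : ℕ} {k : ℤ}
    (h : Even (((n + 2 : ℕ) : ℤ) + k)) (h' : Even ((n : ℤ) + k)) :
    valueMap hγ (evenMonomial (n + 2) k h) =
      (((((n + 2 : ℕ) : ℝ) + γ + 1) ^ 2 : ℝ) : ℂ) • domainMap hγ (evenMonomial (n + 2) k h) -
      (((n + 2 : ℕ) : ℂ) * (((n + 2 : ℕ) : ℂ) - 1)) • domainMap hγ (evenMonomial n k h') := by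
  simp only [valueMap, domainMap, LinearMap.comp_apply, ← map_smul, ← map_sub]
  refine weightedClass_congr hγ fun p hp => ?_
  rw [reducedMap_evenMonomial γ h hp]
  rfl

/-! ### Density -/

theorem span_monomial_topologicalClosure :
    (Submodule.span ℂ (range fun q : ℕ × ℤ => monomial q.1 q.2)).topologicalClosure = ⊤ := by
  set S := range fun q : ℕ × ℤ => monomial q.1 q.2 with hS
  let A : StarSubalgebra ℂ C(FanBeam, ℂ) :=
    { toSubalgebra := Algebra.adjoin ℂ S
      star_mem' := by
        change Algebra.adjoin ℂ S ≤ star (Algebra.adjoin ℂ S)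
        refine Algebra.adjoin_le ?_
        rintro - ⟨⟨n, k⟩, rfl⟩
        refine Algebra.subset_adjoin ⟨(n, -k), ?_⟩
        ext p
        simp only [monomial_apply, ContinuousMap.star_apply, fourier_neg, star_mul', star_pow,
          RCLike.star_def, Complex.conj_ofReal] }
  have hspan : Subalgebra.toSubmodule A.toSubalgebra = Submodule.span ℂ S := by
    refine Algebra.adjoin_eq_span_of_subset ℂ (Subset.trans ?_ Submodule.subset_span)
    intro x hx
    refine Submonoid.closure_induction (fun _ => id) ⟨(0, 0), ?_⟩ ?_ hx
    · ext p
      simp [monomial_apply]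
    · rintro - - - - ⟨⟨n, k⟩, rfl⟩ ⟨⟨m, l⟩, rfl⟩
      exact ⟨(n + m, k + l), (monomial_mul n m k l).symm⟩
  have hsep : A.SeparatesPoints := by
    intro p q hpq
    have hmem : ∀ n k, ∃ φ ∈ (A : Set C(FanBeam, ℂ)), (φ : FanBeam → ℂ) = monomial n k :=
      fun n k => ⟨monomial n k, Algebra.subset_adjoin ⟨(n, k), rfl⟩, rfl⟩
    by_cases h2 : p.2 = q.2
    · obtain ⟨φ, hφ, e⟩ := hmem 0 1
      refine ⟨_, ⟨φ, hφ, rfl⟩, ?_⟩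
      change φ p ≠ φ q
      rw [e, monomial_apply, monomial_apply, pow_zero, pow_zero, one_mul, one_mul, fourier_one,
        fourier_one, h2]
      intro h
      have h3 := AddCircle.injective_toCircle Real.two_pi_pos.ne' (Subtype.ext h)
      exact hpq (Prod.ext (add_right_cancel h3) h2)
    · obtain ⟨φ, hφ, e⟩ := hmem 1 0
      refine ⟨_, ⟨φ, hφ, rfl⟩, ?_⟩
      change φ p ≠ φ q
      rw [e, monomial_apply, monomial_apply, fourier_zero, fourier_zero, mul_one, mul_one, pow_one,
        pow_one]
      intro h
      exact h2 (Subtype.ext (Real.injOn_sin p.2.2 q.2.2 (Complex.ofReal_injective h)))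
  rw [← hspan]
  exact congr_arg (Subalgebra.toSubmodule <| StarSubalgebra.toSubalgebra ·)
    (ContinuousMap.starSubalgebra_topologicalClosure_eq_top_of_separatesPoints A hsep)

theorem memLp_mu_mul {γ : ℝ} (hγ : -1 < γ) (u : L2w γ) :
    MemLp (fun p => (mu p : ℂ) * u p) 2 area := by
  have hac : area ≪ wMeasure γ := fun s hs => by
    have h : ∀ᵐ p ∂wMeasure γ, p ∉ s := measure_eq_zero_iff_ae_notMem.1 hs
    exact measure_eq_zero_iff_ae_notMem.2 ((ae_wMeasure_iff γ).1 h)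
  have hm : AEStronglyMeasurable u area := (Lp.aestronglyMeasurable u).mono_ac hac
  have hmu : AEStronglyMeasurable (fun p => (mu p : ℂ) * u p) area :=
    (Complex.measurable_ofReal.comp measurable_mu).aestronglyMeasurable.mul hm
  have hi := (memLp_two_iff_integrable_sq_norm (Lp.aestronglyMeasurable u)).1 (Lp.memLp u)
  replace hi := (integrable_withDensity_iff_integrable_smul' (measurable_weight γ)
    (Filter.Eventually.of_forall fun _ => ENNReal.ofReal_lt_top)).1 hi
  rw [memLp_two_iff_integrable_sq_norm hmu]
  refine hi.mono' (hmu.norm.pow 2) ?_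
  filter_upwards [ae_interior] with p hp
  have hpos := mu_pos hp
  rw [ENNReal.toReal_ofReal (Real.rpow_nonneg hpos.le _), norm_mul, Complex.norm_real,
    Real.norm_of_nonneg hpos.le, mul_pow, Real.norm_of_nonneg (by positivity), smul_eq_mul]
  refine mul_le_mul_of_nonneg_right ?_ (sq_nonneg _)
  rw [← Real.rpow_natCast]
  exact Real.rpow_le_rpow_of_exponent_ge hpos (mu_le_one p) (by push_cast; linarith)

/-- The functions `μ^{2γ+1} (sin α)^n e^{ik(β + α)}` with `n + k` even are total in `L²₊`. -/
theorem eq_zero_of_inner_evenMonomial {γ : ℝ} (hγ : -1 < γ) (u : L2plus γ)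
    (h : ∀ n k hnk, inner ℂ u (domainMap hγ (evenMonomial n k hnk)) = 0) : u = 0 := by
  set v := (memLp_mu_mul hγ (u : L2w γ)).toLp with hv
  have hva : v =ᵐ[area] fun p => (mu p : ℂ) * (u : L2w γ) p := MemLp.coeFn_toLp _
  have hinner : ∀ φ : C(FanBeam, ℂ), inner ℂ v (ContinuousMap.toLp 2 area ℂ φ) =
      ∫ p, (starRingEnd ℂ) ((mu p : ℂ) * (u : L2w γ) p) * φ p ∂area := fun φ => by
    rw [L2.inner_def]
    refine integral_congr_ae ?_
    filter_upwards [hva, ContinuousMap.coeFn_toLp (p := 2) (𝕜 := ℂ) area φ] with p h1 h2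
    rw [h1, h2, RCLike.inner_apply, mul_comm]
  have hmono : ∀ n k, inner ℂ v (ContinuousMap.toLp 2 area ℂ (monomial n k)) = 0 := by
    intro n k
    rw [hinner]
    rcases Int.even_or_odd ((n : ℤ) + k) with hnk | hnk
    · have h1 := h n k hnk
      rw [domainMap, LinearMap.comp_apply, inner_weightedClass] at h1
      exact h1
    · -- these monomials change sign under `S_A`, while `u` does not
      have hmp := measurePreserving_scatA_area
      have hu := (ae_wMeasure_iff γ).1 (mem_L2plus_iff.1 u.2)
      have hasm : AEStronglyMeasurable (fun p =>
          (starRingEnd ℂ) ((mu p : ℂ) * (u : L2w γ) p) * monomial n k p)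
          (Measure.map scatA area) := by
        rw [hmp.map_eq]
        exact (Complex.continuous_conj.comp_aestronglyMeasurable
          (memLp_mu_mul hγ (u : L2w γ)).aestronglyMeasurable).mul
          (monomial n k).continuous.aestronglyMeasurable
      have h1 := integral_map hmp.measurable.aemeasurable hasm
      rw [hmp.map_eq] at h1
      refine self_eq_neg.1 (h1.trans ?_)
      rw [← integral_neg]
      refine integral_congr_ae ?_
      filter_upwards [hu] with p hp
      rw [Function.comp_apply] at hp
      rw [hp, mu_scatA, monomial_scatA, hnk.neg_one_zpow]
      ring
  let L : C(FanBeam, ℂ) →L[ℂ] ℂ := (innerSL ℂ v).comp (ContinuousMap.toLp 2 area ℂ)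
  have hL : ∀ φ, L φ = 0 := by
    intro φ
    have hle : (Submodule.span ℂ (range fun q : ℕ × ℤ => monomial q.1 q.2)).topologicalClosure ≤
        LinearMap.ker L.toLinearMap := by
      refine Submodule.topologicalClosure_minimal _ (Submodule.span_le.2 ?_) L.isClosed_ker
      rintro _ ⟨⟨n, k⟩, rfl⟩
      exact hmono n k
    rw [span_monomial_topologicalClosure] at hle
    exact hle (Submodule.mem_top (x := φ))
  have hdense := ContinuousMap.toLp_denseRange (E := ℂ) (p := 2) area ℂ ENNReal.ofNat_ne_top
  have hzero : (fun x : Lp ℂ 2 area => (inner ℂ v x : ℂ)) = fun _ => 0 :=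
    hdense.equalizer (by fun_prop) continuous_const (funext hL)
  have hv0 : v = 0 := inner_self_eq_zero.1 (congrFun hzero v)
  refine Subtype.ext (Lp.ext ?_)
  refine Filter.EventuallyEq.trans ((ae_wMeasure_iff γ).2 ?_)
    (Lp.coeFn_zero ℂ 2 (wMeasure γ)).symm
  filter_upwards [hva, (Lp.coeFn_zero ℂ 2 area), ae_interior] with p h1 h2 h3
  rw [hv0, h2] at h1
  exact (mul_eq_zero.1 h1.symm).resolve_left (Complex.ofReal_ne_zero.2 (mu_pos h3).ne')

/-- Shifting by a non-real `z`, the triangular action on the monomials can be inverted, so that the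
range is dense. -/
theorem eq_zero_of_inner_valueMap_add {γ : ℝ} (hγ : -1 < γ) {z : ℂ} (hz : z.im ≠ 0)
    (u : L2plus γ)
    (h : ∀ f, inner ℂ u (valueMap hγ f + z • domainMap hγ f) = 0) : u = 0 := by
  refine eq_zero_of_inner_evenMonomial hγ u fun n => ?_
  have hne : ∀ r : ℝ, (r : ℂ) + z ≠ 0 := fun r hr => hz (by simpa using congrArg Complex.im hr)
  have hsmul : ∀ (c : ℂ) (x : L2plus γ), inner ℂ u (c • x) = c * inner ℂ u x :=
    fun c x => inner_smul_right u x c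
  induction n using Nat.strong_induction_on with
  | _ n ih =>
    intro k hnk
    have h1 := h (evenMonomial n k hnk)
    rcases lt_or_ge n 2 with hn | hn
    · rw [valueMap_evenMonomial_of_lt_two hγ hn, ← add_smul, hsmul] at h1
      exact (mul_eq_zero.1 h1).resolve_left (hne _)
    · obtain ⟨m, rfl⟩ := Nat.exists_eq_add_of_le' hn
      have hmk : Even ((m : ℤ) + k) := by
        rw [Nat.cast_add, add_right_comm] at hnk
        exact (Int.even_add.1 hnk).2 even_two
      rw [valueMap_evenMonomial_add_two hγ hnk hmk, inner_add_right, inner_sub_right,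
        hsmul, hsmul, hsmul, ih m (by omega) k hmk, mul_zero,
        sub_zero, ← add_mul] at h1
      exact (mul_eq_zero.1 h1).resolve_left (hne _)

end XRayDisk

end

theorem theorem3p2 (γ : ℝ) (hγ : -1 < γ) :
    ∃ A : XRayDisk.L2plus γ →ₗ.[ℂ] XRayDisk.L2plus γ,
      XRayDisk.IsOperatorT γ A ∧ XRayDisk.IsEssentiallySelfAdjoint A := by
  open XRayDisk in
  obtain ⟨A, hA, hess⟩ := exists_isEssentiallySelfAdjoint (domainMap hγ) (valueMap hγ)
    (inner_valueMap_domainMap hγ)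
    (fun u h => eq_zero_of_inner_evenMonomial hγ u fun n k hnk => h (evenMonomial n k hnk))
    (fun u h => eq_zero_of_inner_valueMap_add hγ (z := Complex.I) (by simp) u h)
    (fun u h => eq_zero_of_inner_valueMap_add hγ (z := -Complex.I) (by simp) u fun f => by
      rw [neg_smul, ← sub_eq_add_neg]
      exact h f)
  have hclass : ∀ f : smoothSpace, ((domainMap hγ f : L2w γ) : FanBeam → ℂ) =ᵐ[wMeasure γ]
      muPow (2 * γ + 1) f := fun f => weightedClass_ae hγ _
  have hmem : ∀ f : smoothSpace, (domainMap hγ f, valueMap hγ f) ∈ A.graph := fun f => by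
    rw [hA]
    exact ⟨f, rfl⟩
  refine ⟨A, ⟨fun u => ⟨fun hu => ?_, ?_⟩, fun f hf => ?_, fun u f hf hu => ?_⟩, hess⟩
  · have h := A.mem_graph ⟨u, hu⟩
    rw [hA] at h
    obtain ⟨f, hf⟩ := h
    have hfu : domainMap hγ f = u := congrArg Prod.fst hf
    exact ⟨f, f.2, hfu ▸ hclass f⟩
  · rintro ⟨f, hf, hu⟩
    have hfu : u = domainMap hγ ⟨f, hf⟩ := Subtype.ext (Lp.ext (hu.trans (hclass ⟨f, hf⟩).symm))
    rw [hfu]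
    exact LinearPMap.mem_domain_of_mem_graph (hmem _)
  · exact ⟨⟨domainMap hγ ⟨f, hf⟩, LinearPMap.mem_domain_of_mem_graph (hmem _)⟩, hclass ⟨f, hf⟩⟩
  · have hfu : (u : L2plus γ) = domainMap hγ ⟨f, hf⟩ :=
      Subtype.ext (Lp.ext (hu.trans (hclass ⟨f, hf⟩).symm))
    have hval : A u = valueMap hγ ⟨f, hf⟩ :=
      A.mem_graph_snd_inj (A.mem_graph u) (hmem ⟨f, hf⟩) hfu
    rw [hval]
    exact (weightedClass_ae hγ _).trans (exprT_ae γ ⟨f, hf⟩).symm
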